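/- Let $\Sigma$ be a finite alphabet, $\mathrm{Exp}$ the set of regular expressions over $\Sigma$ (built from $0$, $1$, letters, $+$, $\cdot$, ${}^*$), and $[\![g]\!]\subseteq\Sigma^*$ the usual language of $g\in\mathrm{Exp}$. Fix one hypothesis $e\le w$ with $e\in\mathrm{Exp}$ and $w\in\Sigma^*$, and put $H=\{e\le w\}$ (where $w$ is also read as a product of letters, $1$ if $w$ is empty). *Provability.* $\equiv_H$ is the least congruence on $\mathrm{Exp}$ that satisfies the axioms of Kleene algebra (idempotent semiring axioms, $1+f f^*=f^*=1+f^*f$, and the rules $f+gh\le h\Rightarrow g^*f\le h$, $f+gh\le g\Rightarrow f h^*\le g$, where $f\le g$ abbreviates $f+g=g$) together with $e\le w$ (whose letters are not universally quantified). This proof system is $\mathsf{KA}_H$. *Semantics.* $[\![g]\!]_H$ is the smallest language $L\supseteq[\![g]\!]$ such that $uwv\in L$ implies $u[\![e]\!]v\subseteq L$ for all $u,v\in\Sigma^*$. *Automata.* An automaton has a (possibly infinite) set of states, transitions labelled by letters or by $\epsilon$, one initial and one final state. Write $x\twoheadrightarrow^{u}y$ if $y$ can be reached from $x$ by zero or more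 transitions that together read $u$; $l_{\mathcal X}(x)$ is the set of words $u$ with $x\twoheadrightarrow^{u}x_\oplus$, where $x_\oplus$ is the final state; $\mathcal X$ is an automaton for $g$ if $l_{\mathcal X}(x_0)=[\![g]\!]$ at its initial state $x_0$. Fix a finite automaton $\mathcal Z$ for $e$, with initial state $z_0$ and final state $z_\oplus$, and for every $g\in\mathrm{Exp}$ a finite automaton $\mathcal X_g$ for $g$ (for example by Thompson's construction). *The construction.* For an automaton $\mathcal X$, $T_0(\mathcal X)$ is obtained from $\mathcal X$ by adding, simultaneously for every state $x$ of $\mathcal X$ for which $$\{v: wv\in l_{\mathcal X}(x)\}\subseteq\{v: w'v\in l_{\mathcal X}(x)\text{ for all }w'\in[\![e]\!]\}$$ fails, a fresh disjoint copy of $\mathcal Z$, an $\epsilon$-transition from $x$ to $z_0$ of that copy, and $\epsilon$-transitions from $z_\oplus$ of that copy to every state $x'$ of $\mathcal X$ with $x\twoheadrightarrow^{w}x'$ in $\mathcal X$; the initial and the final state remain those of $\mathcal X$. $T_0^*(\mathcal X)$ is the union of the chain $\mathcal X\sqsubseteq T_0(\mathcal X)\sqsubseteq T_0^2(\mathcal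 X)\sqsubseteq\cdots$. The partial map $r_0:\mathrm{Exp}\rightharpoonup\mathrm{Exp}$ is defined on $g$ exactly when $T_0^*(\mathcal X_g)$ is finite, and then $r_0(g)$ is the regular expression for the initial state of $T_0^*(\mathcal X_g)$. **Corollary.** (1) For all $g,h$ in the domain of $r_0$: if $[\![g]\!]_H=[\![h]\!]_H$ then $g\equiv_H h$. Moreover $\equiv_H$ is decidable on the domain of $r_0$: there is an algorithm that, for all $g,h$ in the domain of $r_0$, halts on input $(g,h)$ and answers whether $g\equiv_H h$. (2) Consequently, if $r_0$ is defined on all of $\mathrm{Exp}$, then $\mathsf{KA}_H$ is complete ($[\![g]\!]_H=[\![h]\!]_H$ implies $g\equiv_H h$ for all $g,h\in\mathrm{Exp}$) and decidable (there is an algorithm that decides $g\equiv_H h$ for all $g,h\in\mathrm{Exp}$). -/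

import Mathlib

open Computability

namespace KAHyp

universe u

variable {α : Type u}

/-! ### The proof systems `KA` and `KA_H` -/

/-- A set of hypotheses; the pair `(e, f)` stands for the inequation `e ≤ f`. -/
abbrev Hypotheses (α : Type u) := Set (RegularExpression α × RegularExpression α)

/-- Provable equivalence `≡_H` in `KA_H`: the least congruence on regular expressions that
satisfies the axioms of Kleene algebra and the inequations in `H`. An inequation `e ≤ f` is
an abbreviation of the equation `e + f = f`. The letters in `H` are not universally quantified. -/
inductive Equiv (H : Hypotheses α) : RegularExpression α → RegularExpression α → Prop
  | refl (e) : Equiv H e e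
  | symm {e f} : Equiv H e f → Equiv H f e
  | trans {e f g} : Equiv H e f → Equiv H f g → Equiv H e g
  | add_congr {e e' f f'} : Equiv H e e' → Equiv H f f' → Equiv H (e + f) (e' + f')
  | mul_congr {e e' f f'} : Equiv H e e' → Equiv H f f' → Equiv H (e * f) (e' * f')
  | star_congr {e e'} : Equiv H e e' → Equiv H e.star e'.star
  | add_zero (e) : Equiv H (e + 0) e
  | add_idem (e) : Equiv H (e + e) e
  | add_comm (e f) : Equiv H (e + f) (f + e)
  | add_assoc (e f g) : Equiv H (e + (f + g)) ((e + f) + g)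
  | mul_zero (e) : Equiv H (e * 0) 0
  | zero_mul (e) : Equiv H (0 * e) 0
  | mul_one (e) : Equiv H (e * 1) e
  | one_mul (e) : Equiv H (1 * e) e
  | mul_assoc (e f g) : Equiv H (e * (f * g)) ((e * f) * g)
  | mul_add (e f g) : Equiv H (e * (f + g)) (e * f + e * g)
  | add_mul (e f g) : Equiv H ((e + f) * g) (e * g + f * g)
  | star_unfold_left (e) : Equiv H (1 + e * e.star) e.star
  | star_unfold_right (e) : Equiv H (1 + e.star * e) e.star
  | star_induct_left {e f g} :
      Equiv H ((e + f * g) + g) g → Equiv H (f.star * e + g) g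
  | star_induct_right {e f g} :
      Equiv H ((e + f * g) + f) f → Equiv H (e * g.star + f) f
  | hyp {e f} : (e, f) ∈ H → Equiv H (e + f) f

/-- The regular expression denoting a single word. -/
def wordExp : List α → RegularExpression α
  | [] => 1
  | a :: w => RegularExpression.char a * wordExp w

/-- The hypothesis set `{e ≤ w}`, consisting of one linear hypothesis. -/
def linearHyp (e : RegularExpression α) (w : List α) : Hypotheses α :=
  {(e, wordExp w)}

/-! ### Hypothesis closure semantics -/

/-- One-step hypothesis closure:
`H(L) = L ∪ ⋃ {u ⟦e⟧ v : u ⟦f⟧ v ⊆ L, (e ≤ f) ∈ H}`. -/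
def hypStep (H : Hypotheses α) (L : Language α) : Language α :=
  {x | x ∈ L ∨ ∃ p ∈ H, ∃ u v : List α,
    (∀ y ∈ p.2.matches', u ++ y ++ v ∈ L) ∧ ∃ y ∈ p.1.matches', x = u ++ y ++ v}

/-- Hypothesis closure `H*(L)`: the smallest language containing `L` that is a fixed point of the
one-step closure, given as the intersection of all of these. -/
def hypClosure (H : Hypotheses α) (L : Language α) : Language α :=
  {x | ∀ M : Language α, L ≤ M → hypStep H M = M → x ∈ M}

/-- Hypothesis closure semantics `⟦e⟧_H = H*(⟦e⟧)`. -/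
def semH (H : Hypotheses α) (e : RegularExpression α) : Language α :=
  hypClosure H e.matches'

/-! ### Automata -/

/-- Automata (possibly infinite) with one initial and one final state; a transition labelled
`some a` reads the letter `a`, a transition labelled `none` is an `ε`-transition. -/
structure Automaton (α : Type u) where
  State : Type
  step : State → Option α → State → Prop
  final : State
  init : State

namespace Automaton

/-- `A.Trace x w y`: the automaton can move from `x` to `y` while reading `w`. -/
inductive Trace (A : Automaton α) : A.State → List α → A.State → Prop
  | refl (x) : Trace A x [] x
  | letter {x a y} : A.step x (some a) y → Trace A x [a] y
  | eps {x y} : A.step x none y → Trace A x [] y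
  | append {x y z u v} : Trace A x u y → Trace A y v z → Trace A x (u ++ v) z

/-- The language accepted by a state. -/
def lang (A : Automaton α) (x : A.State) : Language α := {w | A.Trace x w A.final}

/-- The language accepted by an automaton. -/
def language (A : Automaton α) : Language α := A.lang A.init

/-- `A` is a finite automaton for the regular expression `g`. -/
def Represents (A : Automaton α) (g : RegularExpression α) : Prop :=
  Finite A.State ∧ A.language = g.matches'

end Automaton

/-! ### Patching and the construction `T₀` -/

/-- Transitions of the automaton obtained from `A` by `w`-patching a separate copy of `Z` at every
state in `P`. -/
inductive PatchStep (A Z : Automaton α) (w : List α) (P : Set A.State) :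
    A.State ⊕ (P × Z.State) → Option α → A.State ⊕ (P × Z.State) → Prop
  | base {y a y'} : A.step y a y' → PatchStep A Z w P (Sum.inl y) a (Sum.inl y')
  | copy (p : P) {z a z'} : Z.step z a z' → PatchStep A Z w P (Sum.inr (p, z)) a (Sum.inr (p, z'))
  | enter (p : P) : PatchStep A Z w P (Sum.inl p.1) none (Sum.inr (p, Z.init))
  | exit (p : P) {x'} : A.Trace p.1 w x' →
      PatchStep A Z w P (Sum.inr (p, Z.final)) none (Sum.inl x')

/-- The automaton `A` with a copy of `Z` `w`-patched at every state in `P`, simultaneously. -/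
def patch (A Z : Automaton α) (w : List α) (P : Set A.State) : Automaton α where
  State := A.State ⊕ (P × Z.State)
  step := PatchStep A Z w P
  final := Sum.inl A.final
  init := Sum.inl A.init

/-- Generalised Brzozowski derivative (left residual)
`M⁻¹ L = {v : m v ∈ L for all m ∈ M}`. -/
def leftResidual (M L : Language α) : Language α := {v | ∀ m ∈ M, m ++ v ∈ L}

/-- The states that `T₀` patches: those where `w⁻¹ l(x) ⊆ ⟦e⟧⁻¹ l(x)` fails. -/
def toPatch (e : RegularExpression α) (w : List α) (A : Automaton α) : Set A.State :=
  {x | ¬ (A.lang x).leftQuotient w ≤ leftResidual e.matches' (A.lang x)}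

/-- The construction `T₀` for the hypothesis `e ≤ w` and an automaton `Z` for `e`. -/
def T0 (e : RegularExpression α) (w : List α) (Z A : Automaton α) : Automaton α :=
  patch A Z w (toPatch e w A)

/-- The iterates `X, T₀(X), T₀²(X), …`. -/
def T0iter (e : RegularExpression α) (w : List α) (Z X : Automaton α) : ℕ → Automaton α
  | 0 => X
  | n + 1 => T0 e w Z (T0iter e w Z X n)

/-- The limit (union) of a chain of automata along inclusions `i n` of their state sets: the states
are those of all members of the chain, each identified with its image in the next member, and the
transitions are those present in some member. -/
def chainLimit (C : ℕ → Automaton α) (i : ∀ n, (C n).State → (C (n + 1)).State) :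
    Automaton α where
  State := Quot fun p q : Σ n, (C n).State => q = ⟨p.1 + 1, i p.1 p.2⟩
  step y a y' := ∃ n x x', (C n).step x a x' ∧ y = Quot.mk _ ⟨n, x⟩ ∧ y' = Quot.mk _ ⟨n, x'⟩
  final := Quot.mk _ ⟨0, (C 0).final⟩
  init := Quot.mk _ ⟨0, (C 0).init⟩

/-- `T₀*(X)`, the limit of `X ⊑ T₀(X) ⊑ T₀²(X) ⊑ ⋯`. -/
def T0star (e : RegularExpression α) (w : List α) (Z X : Automaton α) : Automaton α :=
  chainLimit (T0iter e w Z X) fun _ x => Sum.inl x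

/-! ### From finite automata to regular expressions -/

section ToExp

variable [Fintype α]

open Classical in
/-- Expression for the moves from `x` to `y` in at most one transition. -/
noncomputable def stepExp (A : Automaton α) (x y : A.State) : RegularExpression α :=
  (if x = y then 1 else 0) + (if A.step x none y then 1 else 0) +
    ((Finset.univ.filter fun a => A.step x (some a) y).toList.map RegularExpression.char).sum

/-- Kleene's algorithm: expression for the traces from `x` to `y` all of whose intermediate states
are in the list. -/
noncomputable def viaExp (A : Automaton α) :
    List A.State → A.State → A.State → RegularExpression α
  | [], x, y => stepExp A x y
  | z :: l, x, y => viaExp A l x y + viaExp A l x z * (viaExp A l z z).star * viaExp A l z y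

/-- The regular expression for the initial state of a finite automaton. -/
noncomputable def toExp (A : Automaton α) (hA : Finite A.State) : RegularExpression α :=
  viaExp A (@Finset.univ A.State (@Fintype.ofFinite A.State hA)).toList A.init A.final

/-- The candidate partial reduction `r₀` for the hypothesis `e ≤ w`, where `Z` is the automaton for
`e` and `aut g` is the automaton for `g`. It is defined on `g` when `T₀*(aut g)` is finite. -/
noncomputable def r0 (e : RegularExpression α) (w : List α) (Z : Automaton α)
    (aut : RegularExpression α → Automaton α) : RegularExpression α →. RegularExpression α :=
  fun g => ⟨Finite (T0star e w Z (aut g)).State, fun h => toExp (T0star e w Z (aut g)) h⟩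

end ToExp

/-! ### Completeness and decidability -/

/-- `KA_H` is complete with respect to `⟦-⟧_H` over the set `D` of expressions. -/
def CompleteOn (H : Hypotheses α) (D : Set (RegularExpression α)) : Prop :=
  ∀ g ∈ D, ∀ h ∈ D, semH H g = semH H h → Equiv H g h

/-- Gödel numbering of the regular expressions over a finite alphabet. -/
noncomputable def code [Fintype α] : RegularExpression α → ℕ
  | .zero => 0
  | .epsilon => 1
  | .char a => 4 * (Fintype.equivFin α a : ℕ) + 2
  | .plus f g => 4 * Nat.pair (code f) (code g) + 3
  | .comp f g => 4 * Nat.pair (code f) (code g) + 4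
  | .star f => 4 * code f + 5

theorem code_injective [Fintype α] : Function.Injective (code : RegularExpression α → ℕ) := by
  intro f
  induction f with
  | zero => intro g h; cases g <;> simp only [code] at h <;> first | rfl | omega
  | epsilon => intro g h; cases g <;> simp only [code] at h <;> first | rfl | omega
  | char a =>
    intro g h
    cases g <;> simp only [code] at h <;> try omega
    congr 1
    exact (Fintype.equivFin α).injective (Fin.ext (by omega))
  | plus f₁ f₂ ih₁ ih₂ =>
    intro g h
    cases g <;> simp only [code] at h <;> try omega
    have := Nat.pair_eq_pair.1 (Nat.eq_of_mul_eq_mul_left (by decide : 0 < 4)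
      (Nat.add_right_cancel h))
    rw [ih₁ this.1, ih₂ this.2]
  | comp f₁ f₂ ih₁ ih₂ =>
    intro g h
    cases g <;> simp only [code] at h <;> try omega
    have := Nat.pair_eq_pair.1 (Nat.eq_of_mul_eq_mul_left (by decide : 0 < 4)
      (Nat.add_right_cancel h))
    rw [ih₁ this.1, ih₂ this.2]
  | star f ih =>
    intro g h
    cases g <;> simp only [code] at h <;> try omega
    rw [ih (Nat.eq_of_mul_eq_mul_left (by decide : 0 < 4) (Nat.add_right_cancel h))]

/-- The relation `R` on regular expressions is decidable over the set `D`: one algorithm, given (the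
codes of) any two members of `D`, halts and answers whether they are related by `R`. -/
def DecidableOn [Fintype α] (D : Set (RegularExpression α))
    (R : RegularExpression α → RegularExpression α → Prop) : Prop :=
  ∃ d : ℕ × ℕ →. Bool, Partrec d ∧
    ∀ g ∈ D, ∀ h ∈ D, ∃ b ∈ d (code g, code h), (b = true ↔ R g h)

/-! ### Thompson's construction

Every regular expression is represented by a finite automaton. -/

namespace Automaton

theorem Trace.map {A B : Automaton α} (f : A.State → B.State)
    (hf : ∀ x a y, A.step x a y → B.step (f x) a (f y)) {x u y} (t : A.Trace x u y) :
    B.Trace (f x) u (f y) := by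
  induction t with
  | refl => exact .refl _
  | letter h => exact .letter (hf _ _ _ h)
  | eps h => exact .eps (hf _ _ _ h)
  | append _ _ ih₁ ih₂ => exact .append ih₁ ih₂

theorem lang_le {A : Automaton α} (S : A.State → Language α) (h1 : [] ∈ S A.final)
    (hl : ∀ x a y, A.step x (some a) y → ∀ v ∈ S y, a :: v ∈ S x)
    (he : ∀ x y, A.step x none y → ∀ v ∈ S y, v ∈ S x) (x : A.State) : A.lang x ≤ S x := by
  have key : ∀ {x u y}, A.Trace x u y → ∀ v ∈ S y, u ++ v ∈ S x := by
    intro x u y t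
    induction t with
    | refl => exact fun v hv => hv
    | letter h => exact fun v hv => hl _ _ _ h v hv
    | eps h => exact fun v hv => he _ _ h v hv
    | append _ _ ih₁ ih₂ => intro v hv; rw [List.append_assoc]; exact ih₁ _ (ih₂ _ hv)
  intro w hw
  have := key hw [] h1
  rwa [List.append_nil] at this

theorem lang_letter {A : Automaton α} {x a y} (h : A.step x (some a) y) {v} (hv : v ∈ A.lang y) :
    a :: v ∈ A.lang x :=
  Trace.append (.letter h) hv

theorem lang_eps {A : Automaton α} {x y} (h : A.step x none y) {v} (hv : v ∈ A.lang y) :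
    v ∈ A.lang x :=
  Trace.append (.eps h) hv

/-- Two states, joined by the transitions with a label in `p`. -/
def edge (p : Option α → Prop) : Automaton α where
  State := Bool
  step x a y := x = false ∧ y = true ∧ p a
  final := true
  init := false

inductive PlusStep (A B : Automaton α) :
    Bool ⊕ (A.State ⊕ B.State) → Option α → Bool ⊕ (A.State ⊕ B.State) → Prop
  | left {x a y} : A.step x a y → PlusStep A B (.inr (.inl x)) a (.inr (.inl y))
  | right {x a y} : B.step x a y → PlusStep A B (.inr (.inr x)) a (.inr (.inr y))
  | enterLeft : PlusStep A B (.inl false) none (.inr (.inl A.init))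
  | enterRight : PlusStep A B (.inl false) none (.inr (.inr B.init))
  | exitLeft : PlusStep A B (.inr (.inl A.final)) none (.inl true)
  | exitRight : PlusStep A B (.inr (.inr B.final)) none (.inl true)

def plus (A B : Automaton α) : Automaton α where
  State := Bool ⊕ (A.State ⊕ B.State)
  step := PlusStep A B
  final := .inl true
  init := .inl false

inductive CompStep (A B : Automaton α) :
    A.State ⊕ B.State → Option α → A.State ⊕ B.State → Prop
  | left {x a y} : A.step x a y → CompStep A B (.inl x) a (.inl y)
  | right {x a y} : B.step x a y → CompStep A B (.inr x) a (.inr y)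
  | mid : CompStep A B (.inl A.final) none (.inr B.init)

def comp (A B : Automaton α) : Automaton α where
  State := A.State ⊕ B.State
  step := CompStep A B
  final := .inr B.final
  init := .inl A.init

inductive StarStep (A : Automaton α) : Option A.State → Option α → Option A.State → Prop
  | inner {x a y} : A.step x a y → StarStep A (some x) a (some y)
  | enter : StarStep A none none (some A.init)
  | exit : StarStep A (some A.final) none none

def star (A : Automaton α) : Automaton α where
  State := Option A.State
  step := StarStep A
  final := none
  init := none

/-- Thompson's construction. -/
def thompson : RegularExpression α → Automaton α
  | .zero => edge fun _ => False
  | .epsilon => edge fun a => a = none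
  | .char b => edge fun a => a = some b
  | .plus f g => plus (thompson f) (thompson g)
  | .comp f g => comp (thompson f) (thompson g)
  | .star f => star (thompson f)

theorem thompson_finite (g : RegularExpression α) : Finite (thompson g).State := by
  induction g with
  | zero => exact inferInstanceAs (Finite Bool)
  | epsilon => exact inferInstanceAs (Finite Bool)
  | char b => exact inferInstanceAs (Finite Bool)
  | plus f g ihf ihg =>
    exact inferInstanceAs (Finite (Bool ⊕ ((thompson f).State ⊕ (thompson g).State)))
  | comp f g ihf ihg => exact inferInstanceAs (Finite ((thompson f).State ⊕ (thompson g).State))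
  | star f ih => exact inferInstanceAs (Finite (Option (thompson f).State))

theorem plus_language (A B : Automaton α) :
    (plus A B).language = A.language + B.language := by
  apply le_antisymm
  · refine lang_le (A := plus A B)
      (fun s => match s with
        | .inl false => A.language + B.language
        | .inl true => 1
        | .inr (.inl x) => A.lang x
        | .inr (.inr x) => B.lang x) rfl ?_ ?_ (.inl false)
    · rintro _ a _ (h | h) v hv
      · exact lang_letter h hv
      · exact lang_letter h hv
    · rintro _ _ (h | h | _ | _ | _ | _) v hv
      · exact lang_eps h hv
      · exact lang_eps h hv
      · exact Or.inl hv
      · exact Or.inr hv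
      · obtain rfl : v = [] := hv
        exact Trace.refl _
      · obtain rfl : v = [] := hv
        exact Trace.refl _
  · rintro w (hw | hw)
    · have t := Trace.map (B := plus A B) (fun x => .inr (.inl x)) (fun _ _ _ h => .left h) hw
      have := (Trace.append (Trace.eps (A := plus A B) .enterLeft) t).append (.eps .exitLeft)
      rwa [List.nil_append, List.append_nil] at this
    · have t := Trace.map (B := plus A B) (fun x => .inr (.inr x)) (fun _ _ _ h => .right h) hw
      have := (Trace.append (Trace.eps (A := plus A B) .enterRight) t).append (.eps .exitRight)
      rwa [List.nil_append, List.append_nil] at this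

theorem comp_language (A B : Automaton α) :
    (comp A B).language = A.language * B.language := by
  apply le_antisymm
  · refine lang_le (A := comp A B)
      (fun s => match s with
        | .inl x => A.lang x * B.language
        | .inr x => B.lang x) (Trace.refl _) ?_ ?_ (.inl A.init)
    · rintro _ a _ (h | h) v hv
      · obtain ⟨p, hp, q, hq, rfl⟩ := hv
        exact ⟨a :: p, lang_letter h hp, q, hq, rfl⟩
      · exact lang_letter h hv
    · rintro _ _ (h | h | _) v hv
      · obtain ⟨p, hp, q, hq, rfl⟩ := hv
        exact ⟨p, lang_eps h hp, q, hq, rfl⟩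
      · exact lang_eps h hv
      · exact ⟨[], Trace.refl _, v, hv, rfl⟩
  · rintro _ ⟨p, hp, q, hq, rfl⟩
    have tp := Trace.map (B := comp A B) .inl (fun _ _ _ h => .left h) hp
    have tq := Trace.map (B := comp A B) .inr (fun _ _ _ h => .right h) hq
    have := tp.append ((Trace.eps (A := comp A B) .mid).append tq)
    exact this

theorem star_language (A : Automaton α) : (star A).language = A.language∗ := by
  apply le_antisymm
  · refine lang_le (A := star A)
      (fun s => match s with
        | none => A.language∗
        | some x => A.lang x * A.language∗) (Language.nil_mem_kstar _) ?_ ?_ none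
    · rintro _ a _ (h | _) v hv
      obtain ⟨p, hp, q, hq, rfl⟩ := hv
      exact ⟨a :: p, lang_letter h hp, q, hq, rfl⟩
    · rintro _ _ (h | _ | _) v hv
      · obtain ⟨p, hp, q, hq, rfl⟩ := hv
        exact ⟨p, lang_eps h hp, q, hq, rfl⟩
      · exact (mul_kstar_le_kstar : A.language * A.language∗ ≤ _) hv
      · exact ⟨[], Trace.refl _, v, hv, rfl⟩
  · rintro _ ⟨L, rfl, hL⟩
    induction L with
    | nil => exact Trace.refl _
    | cons p L ih =>
      have t := Trace.map (B := star A) some (fun _ _ _ h => .inner h) (hL p (by simp))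
      have := ((Trace.eps (A := star A) .enter).append t).append
        ((Trace.eps (A := star A) .exit).append (ih fun y hy => hL y (by simp [hy])))
      exact this

theorem edge_language (p : Option α → Prop) (w : List α) :
    w ∈ (edge p).language ↔ (w = [] ∧ p none) ∨ ∃ a, w = [a] ∧ p (some a) := by
  constructor
  · intro hw
    refine lang_le (A := edge p)
      (fun s => match s with
        | false => {w | (w = [] ∧ p none) ∨ ∃ a, w = [a] ∧ p (some a)}
        | true => 1) rfl ?_ ?_ false hw
    · rintro _ a _ ⟨rfl, rfl, h⟩ v hv
      obtain rfl : v = [] := hv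
      exact Or.inr ⟨a, rfl, h⟩
    · rintro _ _ ⟨rfl, rfl, h⟩ v hv
      obtain rfl : v = [] := hv
      exact Or.inl ⟨rfl, h⟩
  · rintro (⟨rfl, h⟩ | ⟨a, rfl, h⟩)
    · exact Trace.eps (A := edge p) ⟨rfl, rfl, h⟩
    · exact Trace.letter (A := edge p) ⟨rfl, rfl, h⟩

theorem thompson_language (g : RegularExpression α) : (thompson g).language = g.matches' := by
  induction g with
  | zero =>
    ext w
    simp [thompson, edge_language]
  | epsilon =>
    ext w
    simp [thompson, edge_language]
  | char b =>
    ext w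
    simp only [thompson, edge_language, RegularExpression.matches']
    constructor
    · rintro (⟨_, h⟩ | ⟨a, rfl, h⟩)
      · cases h
      · cases h; rfl
    · rintro rfl
      exact Or.inr ⟨b, rfl, rfl⟩
  | plus f g ihf ihg => rw [thompson, plus_language, ihf, ihg]; rfl
  | comp f g ihf ihg => rw [thompson, comp_language, ihf, ihg]; rfl
  | star f ih => rw [thompson, star_language, ih]; rfl

theorem thompson_represents (g : RegularExpression α) : (thompson g).Represents g :=
  ⟨thompson_finite g, thompson_language g⟩

end Automaton

end KAHyp

/-! Completeness. Interpret a finite automaton in a Kleene algebra by the weights of its traces,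
computed with Kleene's elimination algorithm (`behaviour`). Two facts carry the argument. First,
language inclusion between finite automata implies inequality of behaviours in every Kleene algebra
(`behaviour_mono_of_language_le`); this is the completeness of Kleene algebra without hypotheses.
Second, patching does not change the behaviour in an algebra where `e ≤ w` (`behaviour_patch`),
because a detour through a copy of `Z` weighs no more than the `w`-paths that it runs parallel to.

If `T₀*(X_h)` is finite, some iterate `B` has no state left to patch. Its language is then closed
under the hypothesis (`isClosed_language`), so it contains `⟦h⟧_H`, while its behaviour in the free
model `FreeKA` is still the class of `h`. From `⟦g⟧ ⊆ ⟦g⟧_H = ⟦h⟧_H ⊆ L(B)` it follows that `g ≤ h`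
is provable, and the converse is symmetric. Only the domain of `r₀` matters here, not its values.

Decidability. The choice of the automata `aut g` is not assumed computable, so the iteration cannot
be run. Instead, two searches run in parallel. Provable equations can be enumerated (`derived`). If
`g ≤ h` is unprovable, then `⟦g⟧` is not contained in the regular closed language `L(B)`, and the
syntactic congruence of `L(B)`, extended from words to languages, has finite index, obeys all rules
of `KA_H` and separates `g` from `h` (`sound_contexts`, `finite_range_contexts`). Such a quotient
can be written down as a finite table of numbers (`exists_isModel`), and whether a table is a model
is primitive recursive. Hence every unprovable equation over the domain has a finite countermodel
that a search will find.

The rules are listed once, over an arbitrary algebra (`Ops.rules`), so that one list serves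
expressions, their codes and the tables. -/

open Computability

namespace KAHyp

universe u v

variable {α : Type u}

/-! ### The star of a matrix over a Kleene algebra -/

section MatrixStar

variable {K : Type v} [KleeneAlgebra K] {S : Type*}

/-- Kleene's algorithm over a Kleene algebra: the weight of the paths from `x` to `y` all of whose
intermediate vertices are in the list. -/
def viaStar (M : S → S → K) : List S → S → S → K
  | [], x, y => M x y
  | z :: l, x, y => viaStar M l x y + viaStar M l x z * (viaStar M l z z)∗ * viaStar M l z y

variable {M : S → S → K}

theorem viaStar_le_cons (z : S) (l : List S) (x y : S) :
    viaStar M l x y ≤ viaStar M (z :: l) x y := by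
  rw [viaStar, add_eq_sup]; exact le_sup_left

theorem le_viaStar (l : List S) (x y : S) : M x y ≤ viaStar M l x y := by
  induction l with
  | nil => exact le_rfl
  | cons z l ih => exact ih.trans (viaStar_le_cons z l x y)

/-- Paths compose at any vertex that has been eliminated. If that vertex is the last one eliminated,
its loop star absorbs the extra factors; otherwise distribute, compose at `z` by induction, and
merge two visits to `p` into one `(N p p)∗`. -/
theorem viaStar_mul_viaStar_le {l : List S} {z : S} (hz : z ∈ l) (x y : S) :
    viaStar M l x z * viaStar M l z y ≤ viaStar M l x y := by
  induction l generalizing x y with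
  | nil => cases hz
  | cons p l ih =>
    simp only [viaStar]
    by_cases h : z = p
    · subst h
      set N := viaStar M l
      have h1 : N x z + N x z * (N z z)∗ * N z z ≤ N x z * (N z z)∗ := by
        refine add_le (le_mul_of_one_le_right' one_le_kstar) ?_
        rw [mul_assoc]
        grw [kstar_mul_le_kstar]
      have h2 : N z y + N z z * (N z z)∗ * N z y ≤ (N z z)∗ * N z y := by
        refine add_le (le_mul_of_one_le_left' one_le_kstar) ?_
        grw [mul_kstar_le_kstar]
      grw [h1, h2]
      rw [mul_assoc, ← mul_assoc (N z z)∗, kstar_mul_kstar, ← mul_assoc, add_eq_sup]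
      exact le_sup_right
    · have hz' : z ∈ l := by simpa [h] using hz
      replace ih := ih hz'
      set N := viaStar M l
      rw [add_mul, mul_add, mul_add]
      refine add_le (add_le ?_ ?_) (add_le ?_ ?_)
      · grw [ih]; rw [add_eq_sup]; exact le_sup_left
      · calc N x z * (N z p * (N p p)∗ * N p y) = N x z * N z p * (N p p)∗ * N p y := by
              simp only [mul_assoc]
          _ ≤ N x p * (N p p)∗ * N p y := by grw [ih]
          _ ≤ _ := by rw [add_eq_sup]; exact le_sup_right
      · calc N x p * (N p p)∗ * N p z * N z y = N x p * (N p p)∗ * (N p z * N z y) := by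
              simp only [mul_assoc]
          _ ≤ N x p * (N p p)∗ * N p y := by grw [ih]
          _ ≤ _ := by rw [add_eq_sup]; exact le_sup_right
      · calc N x p * (N p p)∗ * N p z * (N z p * (N p p)∗ * N p y)
            = N x p * ((N p p)∗ * ((N p z * N z p) * (N p p)∗)) * N p y := by
              simp only [mul_assoc]
          _ ≤ N x p * (N p p)∗ * N p y := by
              grw [ih, mul_kstar_le_kstar, kstar_mul_kstar]
          _ ≤ _ := by rw [add_eq_sup]; exact le_sup_right

/-- Each elimination step preserves the pre-fixed point `t`: the loop at `z` is absorbed by left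
star induction. This is the leastness half of the star of a matrix. -/
theorem viaStar_mul_le {t : S → K} (h : ∀ x z, M x z * t z ≤ t x) (l : List S) (x y : S) :
    viaStar M l x y * t y ≤ t x := by
  induction l generalizing x y with
  | nil => exact h x y
  | cons z l ih =>
    rw [viaStar, add_mul]
    refine add_le (ih x y) ?_
    rw [mul_assoc]
    grw [ih z y, mul_assoc, kstar_mul_le_self (ih z z), ih x z]

theorem mul_viaStar_le {t : S → K} (h : ∀ x z, t x * M x z ≤ t z) (l : List S) (x y : S) :
    t x * viaStar M l x y ≤ t y := by
  induction l generalizing x y with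
  | nil => exact h x y
  | cons z l ih =>
    rw [viaStar, mul_add]
    refine add_le (ih x y) ?_
    rw [← mul_assoc, ← mul_assoc]
    grw [ih x z, mul_kstar_le_self (ih z z), ih z y]

theorem sum_le_of_forall {ι : Type*} {s : Finset ι} {f : ι → K} {b : K} (h : ∀ i ∈ s, f i ≤ b) :
    ∑ i ∈ s, f i ≤ b := by
  classical
  induction s using Finset.induction_on with
  | empty => simp
  | insert i s hi ih =>
    rw [Finset.sum_insert hi]
    exact add_le (h i (by simp)) (ih fun j hj => h j (by simp [hj]))

theorem le_sum_of_mem {ι : Type*} {s : Finset ι} (f : ι → K) {i : ι} (hi : i ∈ s) :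
    f i ≤ ∑ i ∈ s, f i :=
  Finset.single_le_sum_of_canonicallyOrdered hi

end MatrixStar

/-! ### The behaviour of a finite automaton in a Kleene algebra -/

namespace Automaton

variable {K : Type v} [KleeneAlgebra K]

/-- A transition reads at most one letter, so a cut of the word never falls strictly inside a
transition. -/
theorem Trace.split {A : Automaton α} {x z : A.State} {u v : List α}
    (t : A.Trace x (u ++ v) z) : ∃ y, A.Trace x u y ∧ A.Trace y v z := by
  generalize hw : u ++ v = w at t
  induction t generalizing u v with
  | refl x =>
    obtain ⟨rfl, rfl⟩ := List.append_eq_nil_iff.1 hw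
    exact ⟨x, .refl x, .refl x⟩
  | @letter x a y h =>
    rcases List.append_eq_singleton_iff.1 hw with ⟨rfl, rfl⟩ | ⟨rfl, rfl⟩
    · exact ⟨x, .refl x, .letter h⟩
    · exact ⟨y, .letter h, .refl y⟩
  | @eps x y h =>
    obtain ⟨rfl, rfl⟩ := List.append_eq_nil_iff.1 hw
    exact ⟨x, .refl x, .eps h⟩
  | append t₁ t₂ ih₁ ih₂ =>
    rcases List.append_eq_append_iff.1 hw with ⟨s, rfl, rfl⟩ | ⟨s, rfl, rfl⟩
    · obtain ⟨y, h₁, h₂⟩ := ih₁ rfl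
      exact ⟨y, h₁, h₂.append t₂⟩
    · obtain ⟨y, h₁, h₂⟩ := ih₂ rfl
      exact ⟨y, t₁.append h₁, h₂⟩

/-- The weight of the label of a transition. -/
def weight (k : α → K) : Option α → K
  | none => 1
  | some a => k a

variable [Fintype α]

open Classical in
/-- The weight of the moves from `x` to `y` in at most one transition. -/
noncomputable def stepWeight (A : Automaton α) (k : α → K) (x y : A.State) : K :=
  (if x = y then 1 else 0) + ∑ a with A.step x a y, weight k a

/-- The weight of the traces from `x` to `y`. -/
noncomputable def behaviour (A : Automaton α) [Finite A.State] (k : α → K) (x y : A.State) : K :=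
  viaStar (A.stepWeight k) (@Finset.univ A.State (Fintype.ofFinite _)).toList x y

variable {A B : Automaton α} [Finite A.State] [Finite B.State] {k : α → K}

theorem one_le_behaviour (x : A.State) : 1 ≤ A.behaviour k x x := by
  refine le_trans ?_ (le_viaStar _ x x)
  rw [stepWeight, if_pos rfl, add_eq_sup]
  exact le_sup_left

theorem weight_le_behaviour {x y : A.State} {a : Option α} (h : A.step x a y) :
    weight k a ≤ A.behaviour k x y := by
  classical
  refine le_trans ?_ (le_viaStar _ x y)
  rw [stepWeight, add_eq_sup]
  exact le_sup_of_le_right (le_sum_of_mem (weight k) (by simpa using h))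

theorem behaviour_mul_behaviour_le (x y z : A.State) :
    A.behaviour k x y * A.behaviour k y z ≤ A.behaviour k x z :=
  viaStar_mul_viaStar_le (by simp) x z

theorem behaviour_mul_le {t : A.State → K}
    (h : ∀ x a z, A.step x a z → weight k a * t z ≤ t x) (x y : A.State) :
    A.behaviour k x y * t y ≤ t x := by
  classical
  refine viaStar_mul_le (fun x z => ?_) _ x y
  rw [stepWeight, add_mul, Finset.sum_mul]
  refine add_le ?_ (sum_le_of_forall fun a ha => h x a z (by simpa using ha))
  split_ifs with hxz
  · rw [hxz, one_mul]
  · simp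

theorem mul_behaviour_le {t : A.State → K}
    (h : ∀ x a z, A.step x a z → t x * weight k a ≤ t z) (x y : A.State) :
    t x * A.behaviour k x y ≤ t y := by
  classical
  refine mul_viaStar_le (fun x z => ?_) _ x y
  rw [stepWeight, mul_add, Finset.mul_sum]
  refine add_le ?_ (sum_le_of_forall fun a ha => h x a z (by simpa using ha))
  split_ifs with hxz
  · rw [hxz, mul_one]
  · simp

/-- The main tool for upper bounds: guess a value for each state and check it against single
transitions. -/
theorem behaviour_le {t : A.State → K} {y : A.State}
    (h : ∀ x a z, A.step x a z → weight k a * t z ≤ t x) (hy : 1 ≤ t y) (x : A.State) :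
    A.behaviour k x y ≤ t x :=
  (le_mul_of_one_le_right' hy).trans (behaviour_mul_le h x y)

theorem weight_mul_behaviour_le {x y z : A.State} {a : Option α} (h : A.step x a y) :
    weight k a * A.behaviour k y z ≤ A.behaviour k x z := by
  grw [weight_le_behaviour h, behaviour_mul_behaviour_le]

theorem behaviour_map (f : A.State → B.State)
    (hf : ∀ x a y, A.step x a y → B.step (f x) a (f y)) (x y : A.State) :
    A.behaviour k x y ≤ B.behaviour k (f x) (f y) :=
  behaviour_le (t := fun x => B.behaviour k (f x) (f y))
    (fun _ _ _ h => weight_mul_behaviour_le (hf _ _ _ h)) (one_le_behaviour _) x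

/-- The weight of a word. -/
def wordWeight (k : α → K) (w : List α) : K := (w.map k).prod

theorem wordWeight_le_behaviour {x y : A.State} {w : List α} (t : A.Trace x w y) :
    wordWeight k w ≤ A.behaviour k x y := by
  induction t with
  | refl x => simpa [wordWeight] using one_le_behaviour x
  | letter h => simpa [wordWeight, weight] using weight_le_behaviour (k := k) h
  | eps h => simpa [wordWeight, weight] using weight_le_behaviour (k := k) h
  | append _ _ ih₁ ih₂ =>
    rw [wordWeight, List.map_append, List.prod_append]
    exact (mul_le_mul' ih₁ ih₂).trans (behaviour_mul_behaviour_le _ _ _)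

/-! ### Language inclusion is sound in every Kleene algebra -/

/-- The product of `A` with the determinisation of `B`, restricted to the pairs `(x, Q)` such that
`Q` accepts every word that `x` accepts. The choice of the final state is immaterial. -/
def simulation (A B : Automaton α) (h : A.language ≤ B.language) : Automaton α where
  State := {c : A.State × Set B.State //
    ∀ v, A.Trace c.1 v A.final → ∃ y ∈ c.2, B.Trace y v B.final}
  step c a d := A.step c.1.1 a d.1.1 ∧
    d.1.2 = {y' | ∃ y ∈ c.1.2, B.Trace y a.toList y'}
  final := ⟨(A.init, {y | B.Trace B.init [] y}), fun _ hv => ⟨B.init, .refl _, h hv⟩⟩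
  init := ⟨(A.init, {y | B.Trace B.init [] y}), fun _ hv => ⟨B.init, .refl _, h hv⟩⟩

/-- The automaton `C` mediates. Every transition of `A` lifts to `C`, which bounds the behaviour of
`A` by that of `C`; every transition of `C` is matched in `B` by traces into the new subset, which
bounds `C` by `B`. The invariant on pairs ensures that the subset paired with `A.final` contains a
state accepting the empty word. -/
theorem behaviour_mono_of_language_le (h : A.language ≤ B.language) :
    A.behaviour k A.init A.final ≤ B.behaviour k B.init B.final := by
  classical
  let C := simulation A B h
  have : Finite C.State := inferInstanceAs (Finite {c : A.State × Set B.State // _})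
  let := Fintype.ofFinite C.State
  let := Fintype.ofFinite B.State
  -- The weight of all runs of `C` from its initial state into some pair above `x`. It is closed
  -- under the transitions of `A` because the invariant of `C` survives each step, by `Trace.split`.
  let t : A.State → K := fun x => ∑ c : C.State with c.1.1 = x, C.behaviour k C.init c
  have ht : ∀ x a z, A.step x a z → t x * weight k a ≤ t z := by
    intro x a z hs
    rw [Finset.sum_mul]
    refine sum_le_of_forall fun c hc => ?_
    obtain rfl : c.1.1 = x := by simpa using hc
    let d : C.State := ⟨(z, {y' | ∃ y ∈ c.1.2, B.Trace y a.toList y'}), fun v hv => by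
      have htr : A.Trace c.1.1 (a.toList ++ v) A.final := by
        cases a with
        | none => exact .append (.eps hs) hv
        | some a => exact .append (.letter hs) hv
      obtain ⟨y, hy, hyv⟩ := c.2 _ htr
      obtain ⟨y', h1, h2⟩ := Trace.split hyv
      exact ⟨y', ⟨y, hy, h1⟩, h2⟩⟩
    have hd : C.step c a d := ⟨hs, rfl⟩
    refine le_trans ?_ (le_sum_of_mem (fun c : C.State => C.behaviour k C.init c)
      (Finset.mem_filter.2 ⟨Finset.mem_univ d, rfl⟩))
    grw [weight_le_behaviour hd, behaviour_mul_behaviour_le]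
  have h1 : 1 ≤ t A.init :=
    (one_le_behaviour C.init).trans (le_sum_of_mem (fun c : C.State => C.behaviour k C.init c)
      (Finset.mem_filter.2 ⟨Finset.mem_univ C.init, rfl⟩))
  refine (le_mul_of_one_le_left' h1).trans ((mul_behaviour_le ht _ _).trans ?_)
  refine sum_le_of_forall fun c hc => ?_
  have hcf : c.1.1 = A.final := by simpa using hc
  -- The total behaviour in `B` of the subset component; it bounds from above the runs of `C` from a
  -- given pair into `c`.
  let s : C.State → K := fun c => ∑ y : B.State with y ∈ c.1.2, B.behaviour k y B.final
  have hs : ∀ c a d, C.step c a d → weight k a * s d ≤ s c := by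
    rintro c a d ⟨-, hd⟩
    rw [Finset.mul_sum]
    refine sum_le_of_forall fun y' hy' => ?_
    have : y' ∈ d.1.2 := by simpa using hy'
    rw [hd] at this
    obtain ⟨y, hy, htr⟩ := this
    refine le_trans ?_ (le_sum_of_mem (fun y => B.behaviour k y B.final)
      (show y ∈ Finset.univ.filter fun y => y ∈ c.1.2 by simpa using hy))
    have hw : weight k a = wordWeight k a.toList := by cases a <;> simp [weight, wordWeight]
    grw [hw, wordWeight_le_behaviour htr, behaviour_mul_behaviour_le]
  have hsc : 1 ≤ s c := by
    obtain ⟨y, hy, hyf⟩ := c.2 [] (by rw [hcf]; exact .refl _)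
    refine le_trans ?_ (le_sum_of_mem (fun y => B.behaviour k y B.final)
      (show y ∈ Finset.univ.filter fun y => y ∈ c.1.2 by simpa using hy))
    simpa [wordWeight] using wordWeight_le_behaviour (k := k) hyf
  refine (behaviour_le hs hsc C.init).trans (sum_le_of_forall fun y hy => ?_)
  have hy' : B.Trace B.init [] y := (Finset.mem_filter.1 hy).2
  have := wordWeight_le_behaviour (k := k) hy'
  rw [wordWeight, List.map_nil, List.prod_nil] at this
  exact (le_mul_of_one_le_left' this).trans (behaviour_mul_behaviour_le _ _ _)

/-! ### Kleene's theorem -/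

/-- The value of a regular expression in a Kleene algebra. -/
def eval (k : α → K) : RegularExpression α → K
  | .zero => 0
  | .epsilon => 1
  | .char a => k a
  | .plus f g => eval k f + eval k g
  | .comp f g => eval k f * eval k g
  | .star f => (eval k f)∗

instance edge_finite (p : Option α → Prop) : Finite (edge p).State :=
  inferInstanceAs (Finite Bool)

instance plus_finite : Finite (plus A B).State :=
  inferInstanceAs (Finite (Bool ⊕ (A.State ⊕ B.State)))

instance comp_finite : Finite (comp A B).State :=
  inferInstanceAs (Finite (A.State ⊕ B.State))

instance star_finite : Finite (star A).State :=
  inferInstanceAs (Finite (Option A.State))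

instance thompson_state_finite (g : RegularExpression α) : Finite (thompson g).State :=
  thompson_finite g

theorem behaviour_edge (p : Option α → Prop) [DecidablePred p] :
    (edge p).behaviour k (edge p).init (edge p).final = ∑ a with p a, weight k a := by
  apply le_antisymm
  · refine behaviour_le (A := edge p) (y := (edge p).final)
      (t := fun s : Bool => if s then 1 else ∑ a with p a, weight k a) ?_ (by simp [edge]) _
    rintro _ a _ ⟨rfl, rfl, h⟩
    simpa using le_sum_of_mem (weight k) (by simpa using h)
  · refine sum_le_of_forall fun a ha => weight_le_behaviour ⟨rfl, rfl, by simpa using ha⟩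

theorem behaviour_plus :
    (plus A B).behaviour k (plus A B).init (plus A B).final =
      A.behaviour k A.init A.final + B.behaviour k B.init B.final := by
  apply le_antisymm
  · refine behaviour_le (A := plus A B) (y := (plus A B).final)
      (t := fun s => match s with
        | .inl false => A.behaviour k A.init A.final + B.behaviour k B.init B.final
        | .inl true => 1
        | .inr (.inl x) => A.behaviour k x A.final
        | .inr (.inr x) => B.behaviour k x B.final) ?_ le_rfl _
    rintro _ _ _ (h | h | _ | _ | _ | _)
    · exact weight_mul_behaviour_le h
    · exact weight_mul_behaviour_le h
    · simp [weight]
    · simp [weight]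
    · simpa [weight] using one_le_behaviour _
    · simpa [weight] using one_le_behaviour _
  · refine add_le ?_ ?_
    · grw [behaviour_map (A := A) (B := plus A B) (fun x => .inr (.inl x)) (fun _ _ _ h => .left h)]
      refine le_trans ?_ (weight_mul_behaviour_le (A := plus A B) .enterLeft)
      simp only [weight, one_mul]
      refine le_trans ?_ (behaviour_mul_behaviour_le (A := plus A B) _ (.inr (.inl A.final)) _)
      exact le_mul_of_one_le_right' (weight_le_behaviour (A := plus A B) (k := k) .exitLeft)
    · grw [behaviour_map (A := B) (B := plus A B) (fun x => .inr (.inr x)) (fun _ _ _ h => .right h)]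
      refine le_trans ?_ (weight_mul_behaviour_le (A := plus A B) .enterRight)
      simp only [weight, one_mul]
      refine le_trans ?_ (behaviour_mul_behaviour_le (A := plus A B) _ (.inr (.inr B.final)) _)
      exact le_mul_of_one_le_right' (weight_le_behaviour (A := plus A B) (k := k) .exitRight)

theorem behaviour_comp :
    (comp A B).behaviour k (comp A B).init (comp A B).final =
      A.behaviour k A.init A.final * B.behaviour k B.init B.final := by
  apply le_antisymm
  · refine behaviour_le (A := comp A B) (y := (comp A B).final)
      (t := fun s => match s with
        | .inl x => A.behaviour k x A.final * B.behaviour k B.init B.final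
        | .inr x => B.behaviour k x B.final) ?_ (one_le_behaviour _) _
    rintro _ _ _ (h | h | _)
    · simp only [← mul_assoc]
      grw [weight_mul_behaviour_le h]
    · exact weight_mul_behaviour_le h
    · simpa [weight] using le_mul_of_one_le_left' (one_le_behaviour _)
  · grw [behaviour_map (A := A) (B := comp A B) .inl (fun _ _ _ h => .left h),
      behaviour_map (A := B) (B := comp A B) .inr (fun _ _ _ h => .right h)]
    refine le_trans ?_ (behaviour_mul_behaviour_le (A := comp A B) _ (.inl A.final) _)
    refine mul_le_mul' le_rfl ?_
    · have := weight_mul_behaviour_le (A := comp A B) (k := k) (z := .inr B.final) .mid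
      rwa [weight, one_mul] at this

theorem behaviour_star :
    (star A).behaviour k (star A).init (star A).final = (A.behaviour k A.init A.final)∗ := by
  apply le_antisymm
  · refine behaviour_le (A := star A) (y := (star A).final)
      (t := fun s => match s with
        | none => (A.behaviour k A.init A.final)∗
        | some x => A.behaviour k x A.final * (A.behaviour k A.init A.final)∗) ?_ one_le_kstar _
    rintro _ _ _ (h | _ | _)
    · simp only [← mul_assoc]
      grw [weight_mul_behaviour_le h]
    · simpa [weight] using mul_kstar_le_kstar
    · simpa [weight] using le_mul_of_one_le_left' (one_le_behaviour _)
  · refine kstar_le_of_mul_le_right (one_le_behaviour _) ?_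
    refine le_trans ?_ (behaviour_mul_behaviour_le _ (star A).init _)
    refine mul_le_mul' ?_ le_rfl
    · grw [behaviour_map (A := A) (B := star A) some (fun _ _ _ h => .inner h)]
      refine le_trans ?_ (weight_mul_behaviour_le (A := star A) .enter)
      simp only [weight, one_mul]
      refine le_trans ?_ (behaviour_mul_behaviour_le (A := star A) _ (some A.final) _)
      exact le_mul_of_one_le_right' (weight_le_behaviour (A := star A) (k := k) .exit)

theorem behaviour_thompson (g : RegularExpression α) :
    (thompson g).behaviour k (thompson g).init (thompson g).final = eval k g := by
  classical
  induction g with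
  | zero => exact (behaviour_edge _).trans (by simp [eval])
  | epsilon =>
    exact (behaviour_edge _).trans (by simp [eval, weight, Finset.sum_filter])
  | char b => exact (behaviour_edge _).trans (by simp [eval, weight, Finset.filter_eq'])
  | plus f g ihf ihg =>
    exact behaviour_plus.trans (by rw [ihf, ihg, eval])
  | comp f g ihf ihg =>
    exact behaviour_comp.trans (by rw [ihf, ihg, eval])
  | star f ih =>
    exact behaviour_star.trans (by rw [ih, eval])

/-- By monotonicity, a behaviour depends only on the language, so the given automaton may be
replaced by Thompson's. -/
theorem Represents.behaviour_eq {g : RegularExpression α} (h : A.Represents g) :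
    A.behaviour k A.init A.final = eval k g := by
  rw [← behaviour_thompson]
  have hl : A.language = (thompson g).language := h.2.trans (thompson_language g).symm
  exact le_antisymm (behaviour_mono_of_language_le hl.le) (behaviour_mono_of_language_le hl.ge)

end Automaton

/-! ### The free model of `KA_H` -/

/-- Provable equivalence as a setoid. -/
def equivSetoid (H : Hypotheses α) : Setoid (RegularExpression α) where
  r := Equiv H
  iseqv := ⟨.refl, .symm, .trans⟩

/-- Regular expressions modulo provable equivalence. -/
def FreeKA (H : Hypotheses α) : Type u := Quotient (equivSetoid H)

namespace FreeKA

variable {H : Hypotheses α}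

/-- The class of a regular expression. -/
def mk (H : Hypotheses α) (g : RegularExpression α) : FreeKA H := Quotient.mk (equivSetoid H) g

theorem mk_eq_mk {g h : RegularExpression α} : mk H g = mk H h ↔ Equiv H g h :=
  Quotient.eq (r := equivSetoid H)

instance : Zero (FreeKA H) := ⟨mk H 0⟩

instance : One (FreeKA H) := ⟨mk H 1⟩

instance : Add (FreeKA H) :=
  ⟨Quotient.map₂ (· + ·) fun _ _ h _ _ h' => Equiv.add_congr h h'⟩

instance : Mul (FreeKA H) :=
  ⟨Quotient.map₂ (· * ·) fun _ _ h _ _ h' => Equiv.mul_congr h h'⟩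

instance : Semiring (FreeKA H) where
  add_assoc := by
    rintro ⟨a⟩ ⟨b⟩ ⟨c⟩
    exact mk_eq_mk.2 (.symm (.add_assoc a b c))
  zero_add := by
    rintro ⟨a⟩
    exact mk_eq_mk.2 (.trans (.add_comm 0 a) (.add_zero a))
  add_zero := by
    rintro ⟨a⟩
    exact mk_eq_mk.2 (.add_zero a)
  add_comm := by
    rintro ⟨a⟩ ⟨b⟩
    exact mk_eq_mk.2 (.add_comm a b)
  nsmul := nsmulRec
  left_distrib := by
    rintro ⟨a⟩ ⟨b⟩ ⟨c⟩
    exact mk_eq_mk.2 (.mul_add a b c)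
  right_distrib := by
    rintro ⟨a⟩ ⟨b⟩ ⟨c⟩
    exact mk_eq_mk.2 (.add_mul a b c)
  zero_mul := by
    rintro ⟨a⟩
    exact mk_eq_mk.2 (.zero_mul a)
  mul_zero := by
    rintro ⟨a⟩
    exact mk_eq_mk.2 (.mul_zero a)
  mul_assoc := by
    rintro ⟨a⟩ ⟨b⟩ ⟨c⟩
    exact mk_eq_mk.2 (.symm (.mul_assoc a b c))
  one_mul := by
    rintro ⟨a⟩
    exact mk_eq_mk.2 (.one_mul a)
  mul_one := by
    rintro ⟨a⟩
    exact mk_eq_mk.2 (.mul_one a)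

instance : IdemSemiring (FreeKA H) :=
  IdemSemiring.ofSemiring (by rintro ⟨a⟩; exact mk_eq_mk.2 (.add_idem a))

theorem mk_le_mk {g h : RegularExpression α} : mk H g ≤ mk H h ↔ Equiv H (g + h) h :=
  mk_eq_mk (g := g + h)

instance : KleeneAlgebra (FreeKA H) where
  kstar := Quotient.map RegularExpression.star fun _ _ h => Equiv.star_congr h
  one_le_kstar := by
    rintro ⟨a⟩
    have h : (1 : FreeKA H) + mk H (a * a.star) = mk H a.star :=
      mk_eq_mk.2 (.star_unfold_left a)
    exact (le_sup_left.trans_eq ((add_eq_sup _ _).symm.trans h) : (1 : FreeKA H) ≤ _)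
  mul_kstar_le_kstar := by
    rintro ⟨a⟩
    have h : (1 : FreeKA H) + mk H (a * a.star) = mk H a.star :=
      mk_eq_mk.2 (.star_unfold_left a)
    exact (le_sup_right.trans_eq ((add_eq_sup _ _).symm.trans h) : mk H (a * a.star) ≤ _)
  kstar_mul_le_kstar := by
    rintro ⟨a⟩
    have h : (1 : FreeKA H) + mk H (a.star * a) = mk H a.star :=
      mk_eq_mk.2 (.star_unfold_right a)
    exact (le_sup_right.trans_eq ((add_eq_sup _ _).symm.trans h) : mk H (a.star * a) ≤ _)
  mul_kstar_le_self := by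
    rintro ⟨a⟩ ⟨b⟩ h
    refine mk_le_mk.2 (.star_induct_right (mk_le_mk.1 ?_))
    exact (add_le le_rfl h : mk H b + mk H (b * a) ≤ mk H b)
  kstar_mul_le_self := by
    rintro ⟨a⟩ ⟨b⟩ h
    refine mk_le_mk.2 (.star_induct_left (mk_le_mk.1 ?_))
    exact (add_le le_rfl h : mk H b + mk H (a * b) ≤ mk H b)

/-- The canonical interpretation of the letters. -/
def letter (H : Hypotheses α) (a : α) : FreeKA H := mk H (.char a)

theorem eval_letter (g : RegularExpression α) : Automaton.eval (letter H) g = mk H g := by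
  induction g with
  | zero => rfl
  | epsilon => rfl
  | char a => rfl
  | plus f g ihf ihg => rw [Automaton.eval, ihf, ihg]; rfl
  | comp f g ihf ihg => rw [Automaton.eval, ihf, ihg]; rfl
  | star f ih => rw [Automaton.eval, ih]; rfl

theorem wordWeight_letter (w : List α) :
    Automaton.wordWeight (letter H) w = mk H (wordExp w) := by
  induction w with
  | nil => rfl
  | cons a w ih =>
    rw [Automaton.wordWeight, List.map_cons, List.prod_cons]
    exact congrArg (letter H a * ·) ih

/-- The only point where the completeness argument uses the axiom `e ≤ w`. -/
theorem mk_le_wordWeight (e : RegularExpression α) (w : List α) :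
    mk (linearHyp e w) e ≤ Automaton.wordWeight (letter (linearHyp e w)) w := by
  rw [wordWeight_letter, mk_le_mk]
  exact .hyp rfl

end FreeKA

/-! ### Patching -/

section Patch

variable {A Z : Automaton α} {w : List α} {P : Set A.State}

instance patch_finite [Finite A.State] [Finite Z.State] : Finite (patch A Z w P).State :=
  inferInstanceAs (Finite (A.State ⊕ (P × Z.State)))

theorem language_le_patch : A.language ≤ (patch A Z w P).language := fun _ hv =>
  Automaton.Trace.map (B := patch A Z w P) .inl (fun _ _ _ h => .base h) hv

variable {K : Type v} [KleeneAlgebra K] {k : α → K} [Fintype α] [Finite A.State] [Finite Z.State]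

open Automaton in
-- The choice of `P` is irrelevant: a detour at `p` weighs at most `w` and leaves only to states
-- that `p` already reaches by `w`.
theorem behaviour_patch (h : Z.behaviour k Z.init Z.final ≤ wordWeight k w) :
    (patch A Z w P).behaviour k (patch A Z w P).init (patch A Z w P).final =
      A.behaviour k A.init A.final := by
  classical
  let := Fintype.ofFinite A.State
  apply le_antisymm
  · let s (p : A.State) : K := ∑ x with A.Trace p w x, A.behaviour k x A.final
    refine behaviour_le (A := patch A Z w P) (y := (patch A Z w P).final)
      -- From a copy state: finish the run in `Z`, then continue in `A` from any admissible exit.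
      (t := fun c => match c with
        | .inl x => A.behaviour k x A.final
        | .inr (p, z) => Z.behaviour k z Z.final * s p) ?_ (one_le_behaviour _) _
    rintro _ _ _ (h' | ⟨p, h'⟩ | p | ⟨p, h'⟩)
    · exact weight_mul_behaviour_le h'
    · simp only [← mul_assoc]
      grw [weight_mul_behaviour_le h']
    · simp only [weight, one_mul]
      grw [h, Finset.mul_sum]
      refine sum_le_of_forall fun x hx => ?_
      grw [wordWeight_le_behaviour (Finset.mem_filter.1 hx).2, behaviour_mul_behaviour_le]
    · simp only [weight, one_mul]
      refine le_trans ?_ (le_mul_of_one_le_left' (one_le_behaviour _))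
      exact le_sum_of_mem (fun x => A.behaviour k x A.final) (by simpa using h')
  · exact behaviour_map (A := A) (B := patch A Z w P) .inl (fun _ _ _ h => .base h) _ _

end Patch

/-! ### The iteration of `T₀` -/

section Iterate

variable {e : RegularExpression α} {w : List α} {Z X : Automaton α}

instance T0iter_finite [Finite Z.State] [Finite X.State] (n : ℕ) :
    Finite (T0iter e w Z X n).State := by
  induction n with
  | zero => assumption
  | succ n ih => exact patch_finite

theorem language_le_T0iter (n : ℕ) : X.language ≤ (T0iter e w Z X n).language := by
  induction n with
  | zero => exact le_rfl
  | succ n ih => exact ih.trans language_le_patch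

theorem behaviour_T0iter {K : Type v} [KleeneAlgebra K] {k : α → K} [Fintype α]
    [Finite Z.State] [Finite X.State]
    (h : Z.behaviour k Z.init Z.final ≤ Automaton.wordWeight k w) (n : ℕ) :
    (T0iter e w Z X n).behaviour k (T0iter e w Z X n).init (T0iter e w Z X n).final =
      X.behaviour k X.init X.final := by
  induction n with
  | zero => rfl
  | succ n ih => exact (behaviour_patch h).trans ih

/-- The stage at which a state is added. -/
def rank (e : RegularExpression α) (w : List α) (Z X : Automaton α) :
    ∀ n, (T0iter e w Z X n).State → ℕ
  | 0, _ => 0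
  | n + 1, x => Sum.elim (rank e w Z X n) (fun _ => n + 1)
      (show (T0iter e w Z X n).State ⊕ (toPatch e w (T0iter e w Z X n) × Z.State) from x)

/-- If `T₀*(X)` is finite, then the iteration becomes stationary. -/
theorem exists_toPatch_eq_empty (h : Finite (T0star e w Z X).State) :
    ∃ n, toPatch e w (T0iter e w Z X n) = ∅ := by
  by_contra! hne
  -- Passing to the next stage keeps the rank of a state, so the rank is defined on the limit. If
  -- every stage patched some state, each new copy would contribute a new rank.
  let f : (T0star e w Z X).State → ℕ := Quot.lift (fun p => rank e w Z X p.1 p.2) (by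
    rintro ⟨n, x⟩ _ rfl
    rfl)
  have hf (n : ℕ) : n + 1 ∈ Set.range f := by
    obtain ⟨x, hx⟩ := hne n
    exact ⟨Quot.mk _ ⟨n + 1, Sum.inr (⟨x, hx⟩, Z.init)⟩, rfl⟩
  exact Set.infinite_of_injective_forall_mem (add_left_injective 1) hf (Set.finite_range f)

/-- A language is closed under the hypothesis `e ≤ w`. -/
def IsClosed (e : RegularExpression α) (w : List α) (L : Language α) : Prop :=
  ∀ u v, u ++ w ++ v ∈ L → ∀ y ∈ e.matches', u ++ y ++ v ∈ L

/-- Apply the failed patching condition at the state that the accepting run has reached after `u`.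
-/
theorem isClosed_language {A : Automaton α} (h : toPatch e w A = ∅) :
    IsClosed e w A.language := by
  intro u v huv y hy
  rw [List.append_assoc] at huv ⊢
  obtain ⟨x, hx, hv⟩ := Automaton.Trace.split huv
  have hle : (A.lang x).leftQuotient w ≤ leftResidual e.matches' (A.lang x) := by
    by_contra hc
    exact (h ▸ (show x ∈ toPatch e w A from hc) : x ∈ (∅ : Set A.State))
  exact hx.append (hle hv y hy)

theorem matches'_wordExp (w : List α) : (wordExp w).matches' = {w} := by
  induction w with
  | nil => rfl
  | cons a w ih =>
    rw [wordExp, RegularExpression.matches'_mul, ih, RegularExpression.matches'_char]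
    exact Set.image2_singleton

theorem semH_le {g : RegularExpression α} {L : Language α} (hL : IsClosed e w L)
    (hg : g.matches' ≤ L) : semH (linearHyp e w) g ≤ L := by
  intro x hx
  refine hx L hg (Set.Subset.antisymm ?_ fun y hy => Or.inl hy)
  rintro _ (hy | ⟨_, rfl, u, v, hw, y, hy, rfl⟩)
  · exact hy
  · exact hL u v (hw w (by rw [matches'_wordExp]; rfl)) y hy

theorem matches'_le_semH (H : Hypotheses α) (g : RegularExpression α) :
    g.matches' ≤ semH H g := fun _ hx _ hM _ => hM hx

/-- If `T₀*` is finite on an automaton for `h`, then `⟦h⟧` is contained in a regular closed language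
that includes `⟦g⟧` only if `g` is provably below `h`. -/
theorem exists_closed_automaton [Fintype α] (hZ : Z.Represents e) {h : RegularExpression α}
    (hX : X.Represents h) (hfin : Finite (T0star e w Z X).State) :
    ∃ B : Automaton α, Finite B.State ∧ IsClosed e w B.language ∧ h.matches' ≤ B.language ∧
      ∀ g : RegularExpression α, g.matches' ≤ B.language →
        FreeKA.mk (linearHyp e w) g ≤ FreeKA.mk (linearHyp e w) h := by
  have := hZ.1
  have := hX.1
  obtain ⟨n, hn⟩ := exists_toPatch_eq_empty hfin
  refine ⟨T0iter e w Z X n, inferInstance, isClosed_language hn, hX.2.ge.trans (language_le_T0iter n),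
    fun g hg => ?_⟩
  have hZw : Z.behaviour (FreeKA.letter (linearHyp e w)) Z.init Z.final ≤
      Automaton.wordWeight (FreeKA.letter (linearHyp e w)) w := by
    rw [hZ.behaviour_eq, FreeKA.eval_letter]
    exact FreeKA.mk_le_wordWeight e w
  rw [← FreeKA.eval_letter g, ← FreeKA.eval_letter h, ← hX.behaviour_eq,
    ← behaviour_T0iter (e := e) hZw n, ← Automaton.behaviour_thompson]
  exact Automaton.behaviour_mono_of_language_le ((Automaton.thompson_language g).le.trans hg)

end Iterate

/-! ### The rules of `KA_H` in an arbitrary algebra -/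

/-- An interpretation of the operations of Kleene algebra, not subject to any laws. -/
structure Ops (T : Type v) where
  zero : T
  one : T
  plus : T → T → T
  comp : T → T → T
  star : T → T

namespace Ops

variable {T : Type u} {T' : Type v}

/-- The instances of the rules of `KA_H`, for the hypothesis `e ≤ w`, at the parameters `a`, `b`,
`c`, `d`. A rule consists of two premises and a conclusion, all of them equations; the premise
`0 = 0` stands for a missing one. -/
def rules (O : Ops T) (e w a b c d : T) : List ((T × T) × (T × T) × (T × T)) :=
  [((O.zero, O.zero), (O.zero, O.zero), (a, a)),
    ((a, b), (O.zero, O.zero), (b, a)),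
    ((a, b), (b, c), (a, c)),
    ((a, b), (c, d), (O.plus a c, O.plus b d)),
    ((a, b), (c, d), (O.comp a c, O.comp b d)),
    ((a, b), (O.zero, O.zero), (O.star a, O.star b)),
    ((O.zero, O.zero), (O.zero, O.zero), (O.plus a O.zero, a)),
    ((O.zero, O.zero), (O.zero, O.zero), (O.plus a a, a)),
    ((O.zero, O.zero), (O.zero, O.zero), (O.plus a b, O.plus b a)),
    ((O.zero, O.zero), (O.zero, O.zero), (O.plus a (O.plus b c), O.plus (O.plus a b) c)),
    ((O.zero, O.zero), (O.zero, O.zero), (O.comp a O.zero, O.zero)),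
    ((O.zero, O.zero), (O.zero, O.zero), (O.comp O.zero a, O.zero)),
    ((O.zero, O.zero), (O.zero, O.zero), (O.comp a O.one, a)),
    ((O.zero, O.zero), (O.zero, O.zero), (O.comp O.one a, a)),
    ((O.zero, O.zero), (O.zero, O.zero), (O.comp a (O.comp b c), O.comp (O.comp a b) c)),
    ((O.zero, O.zero), (O.zero, O.zero),
      (O.comp a (O.plus b c), O.plus (O.comp a b) (O.comp a c))),
    ((O.zero, O.zero), (O.zero, O.zero),
      (O.comp (O.plus a b) c, O.plus (O.comp a c) (O.comp b c))),
    ((O.zero, O.zero), (O.zero, O.zero), (O.plus O.one (O.comp a (O.star a)), O.star a)),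
    ((O.zero, O.zero), (O.zero, O.zero), (O.plus O.one (O.comp (O.star a) a), O.star a)),
    ((O.plus (O.plus a (O.comp b c)) c, c), (O.zero, O.zero),
      (O.plus (O.comp (O.star b) a) c, c)),
    ((O.plus (O.plus a (O.comp b c)) b, b), (O.zero, O.zero),
      (O.plus (O.comp a (O.star c)) b, b)),
    ((O.zero, O.zero), (O.zero, O.zero), (O.plus e w, w))]

/-- The relation `R` satisfies all rules whose parameters are in `S`. -/
def Sound (O : Ops T) (e w : T) (S : Set T) (R : T → T → Prop) : Prop :=
  ∀ a ∈ S, ∀ b ∈ S, ∀ c ∈ S, ∀ d ∈ S, ∀ r ∈ O.rules e w a b c d,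
    R r.1.1 r.1.2 → R r.2.1.1 r.2.1.2 → R r.2.2.1 r.2.2.2

/-- Homomorphisms of algebras. -/
structure IsHom (O : Ops T) (O' : Ops T') (f : T → T') : Prop where
  zero : f O.zero = O'.zero
  one : f O.one = O'.one
  plus (a b) : f (O.plus a b) = O'.plus (f a) (f b)
  comp (a b) : f (O.comp a b) = O'.comp (f a) (f b)
  star (a) : f (O.star a) = O'.star (f a)

variable {O : Ops T} {O' : Ops T'} {f : T → T'}

/-- The rules are built from the operations alone, so homomorphisms commute with them; this is how
soundness is carried between expressions, codes and tables. -/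
theorem IsHom.rules_eq (hf : IsHom O O' f) (e w a b c d : T) :
    O'.rules (f e) (f w) (f a) (f b) (f c) (f d) =
      (O.rules e w a b c d).map (Prod.map (Prod.map f f) (Prod.map (Prod.map f f)
        (Prod.map f f))) := by
  simp only [rules, List.map_cons, List.map_nil, Prod.map, hf.zero, hf.one, hf.plus, hf.comp,
    hf.star]

theorem Sound.comap (hf : IsHom O O' f) {e w : T} {S : Set T'} {R : T' → T' → Prop}
    (h : O'.Sound (f e) (f w) S R) (hS : ∀ a, f a ∈ S) :
    O.Sound e w Set.univ (fun a b => R (f a) (f b)) := by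
  intro a _ b _ c _ d _ r hr
  have := h (f a) (hS a) (f b) (hS b) (f c) (hS c) (f d) (hS d)
  rw [hf.rules_eq] at this
  exact this _ (List.mem_map_of_mem hr)

theorem Sound.map (hf : IsHom O O' f) {e w : T} {S : Set T'} {R : T' → T' → Prop}
    (h : O.Sound e w Set.univ (fun a b => R (f a) (f b))) (hS : S ⊆ Set.range f) :
    O'.Sound (f e) (f w) S R := by
  intro a ha b hb c hc d hd r hr
  obtain ⟨a, rfl⟩ := hS ha
  obtain ⟨b, rfl⟩ := hS hb
  obtain ⟨c, rfl⟩ := hS hc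
  obtain ⟨d, rfl⟩ := hS hd
  rw [hf.rules_eq] at hr
  obtain ⟨r, hr', rfl⟩ := List.mem_map.1 hr
  exact h a trivial b trivial c trivial d trivial r hr'

end Ops

/-- The algebra of regular expressions. -/
def expOps (α : Type u) : Ops (RegularExpression α) where
  zero := 0
  one := 1
  plus := (· + ·)
  comp := (· * ·)
  star := .star

variable {e : RegularExpression α} {w : List α}

theorem sound_equiv :
    (expOps α).Sound e (wordExp w) Set.univ (Equiv (linearHyp e w)) := by
  intro a _ b _ c _ d _
  simp only [Ops.rules, List.forall_mem_cons, expOps]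
  exact ⟨fun _ _ => .refl _, fun h _ => .symm h, fun h h' => .trans h h',
    fun h h' => .add_congr h h', fun h h' => .mul_congr h h', fun h _ => .star_congr h,
    fun _ _ => .add_zero _, fun _ _ => .add_idem _, fun _ _ => .add_comm _ _,
    fun _ _ => .add_assoc _ _ _, fun _ _ => .mul_zero _, fun _ _ => .zero_mul _,
    fun _ _ => .mul_one _, fun _ _ => .one_mul _, fun _ _ => .mul_assoc _ _ _,
    fun _ _ => .mul_add _ _ _, fun _ _ => .add_mul _ _ _, fun _ _ => .star_unfold_left _,
    fun _ _ => .star_unfold_right _, fun h _ => .star_induct_left h,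
    fun h _ => .star_induct_right h, fun _ _ => .hyp rfl, by simp⟩

/-- The list of rules is complete: provability is the least relation closed under it. `R 0 0`
discharges the dummy premises. -/
theorem Equiv.rel_of_sound {R : RegularExpression α → RegularExpression α → Prop}
    (hR : (expOps α).Sound e (wordExp w) Set.univ R) (h0 : R 0 0) {g h : RegularExpression α}
    (hgh : Equiv (linearHyp e w) g h) : R g h := by
  have key (a b c d : RegularExpression α) := hR a trivial b trivial c trivial d trivial
  simp only [Ops.rules, List.forall_mem_cons, expOps] at key
  induction hgh with
  | refl a => exact (key a a a a).1 h0 h0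
  | symm _ ih => exact (key _ _ 0 0).2.1 ih h0
  | trans _ _ ih ih' => exact (key _ _ _ 0).2.2.1 ih ih'
  | add_congr _ _ ih ih' => exact (key _ _ _ _).2.2.2.1 ih ih'
  | mul_congr _ _ ih ih' => exact (key _ _ _ _).2.2.2.2.1 ih ih'
  | star_congr _ ih => exact (key _ _ 0 0).2.2.2.2.2.1 ih h0
  | add_zero a => exact (key a a a a).2.2.2.2.2.2.1 h0 h0
  | add_idem a => exact (key a a a a).2.2.2.2.2.2.2.1 h0 h0
  | add_comm a b => exact (key a b a a).2.2.2.2.2.2.2.2.1 h0 h0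
  | add_assoc a b c => exact (key a b c a).2.2.2.2.2.2.2.2.2.1 h0 h0
  | mul_zero a => exact (key a a a a).2.2.2.2.2.2.2.2.2.2.1 h0 h0
  | zero_mul a => exact (key a a a a).2.2.2.2.2.2.2.2.2.2.2.1 h0 h0
  | mul_one a => exact (key a a a a).2.2.2.2.2.2.2.2.2.2.2.2.1 h0 h0
  | one_mul a => exact (key a a a a).2.2.2.2.2.2.2.2.2.2.2.2.2.1 h0 h0
  | mul_assoc a b c => exact (key a b c a).2.2.2.2.2.2.2.2.2.2.2.2.2.2.1 h0 h0
  | mul_add a b c => exact (key a b c a).2.2.2.2.2.2.2.2.2.2.2.2.2.2.2.1 h0 h0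
  | add_mul a b c => exact (key a b c a).2.2.2.2.2.2.2.2.2.2.2.2.2.2.2.2.1 h0 h0
  | star_unfold_left a => exact (key a a a a).2.2.2.2.2.2.2.2.2.2.2.2.2.2.2.2.2.1 h0 h0
  | star_unfold_right a => exact (key a a a a).2.2.2.2.2.2.2.2.2.2.2.2.2.2.2.2.2.2.1 h0 h0
  | star_induct_left _ ih =>
    exact (key _ _ _ 0).2.2.2.2.2.2.2.2.2.2.2.2.2.2.2.2.2.2.2.1 ih h0
  | star_induct_right _ ih =>
    exact (key _ _ _ 0).2.2.2.2.2.2.2.2.2.2.2.2.2.2.2.2.2.2.2.2.1 ih h0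
  | hyp h =>
    cases h
    exact (key 0 0 0 0).2.2.2.2.2.2.2.2.2.2.2.2.2.2.2.2.2.2.2.2.2.1 h0 h0

/-! ### The syntactic congruence of a closed language -/

/-- The contexts that take all words of `X` to words of `L`. -/
def contexts (L X : Language α) : Set (List α × List α) := {p | ∀ x ∈ X, p.1 ++ x ++ p.2 ∈ L}

section Contexts

variable {L : Language α}

theorem contexts_add (X Y : Language α) : contexts L (X + Y) = contexts L X ∩ contexts L Y :=
  Set.ext fun _ => ⟨fun h => ⟨fun x hx => h x (.inl hx), fun x hx => h x (.inr hx)⟩,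
    fun h x hx => hx.elim (h.1 x) (h.2 x)⟩

theorem mem_contexts_mul {X Y : Language α} {u v : List α} :
    (u, v) ∈ contexts L (X * Y) ↔ ∀ x ∈ X, ∀ y ∈ Y, u ++ x ++ y ++ v ∈ L := by
  constructor
  · intro h x hx y hy
    simpa using h (x ++ y) ⟨x, hx, y, hy, rfl⟩
  · rintro h _ ⟨x, hx, y, hy, rfl⟩
    simpa using h x hx y hy

theorem mem_contexts_mul_iff_left {X Y : Language α} {u v : List α} :
    (u, v) ∈ contexts L (X * Y) ↔ ∀ y ∈ Y, (u, y ++ v) ∈ contexts L X := by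
  rw [mem_contexts_mul]
  exact ⟨fun h y hy x hx => by simpa using h x hx y hy,
    fun h x hx y hy => by simpa using h y hy x hx⟩

theorem mem_contexts_mul_iff_right {X Y : Language α} {u v : List α} :
    (u, v) ∈ contexts L (X * Y) ↔ ∀ x ∈ X, (u ++ x, v) ∈ contexts L Y :=
  mem_contexts_mul

/-- Words of one factor can be moved into the context of the other, so the factors can be exchanged
one at a time. -/
theorem contexts_mul_subset {X X' Y Y' : Language α} (hX : contexts L X ⊆ contexts L X')
    (hY : contexts L Y ⊆ contexts L Y') : contexts L (X * Y) ⊆ contexts L (X' * Y') := by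
  rintro ⟨u, v⟩ h
  have h' : (u, v) ∈ contexts L (X' * Y) :=
    mem_contexts_mul_iff_left.2 fun y hy => hX (mem_contexts_mul_iff_left.1 h y hy)
  exact mem_contexts_mul_iff_right.2 fun x hx => hY (mem_contexts_mul_iff_right.1 h' x hx)

theorem mem_contexts_kstar {X : Language α} {p : List α × List α} :
    p ∈ contexts L X∗ ↔ ∀ n, p ∈ contexts L (X ^ n) := by
  simp only [contexts, Language.kstar_eq_iSup_pow, Set.mem_ofPred_eq, Language.mem_iSup]
  exact ⟨fun h n x hx => h x ⟨n, hx⟩, fun h x ⟨n, hx⟩ => h n x hx⟩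

theorem contexts_kstar_subset {X Y : Language α} (h : contexts L X ⊆ contexts L Y) :
    contexts L X∗ ⊆ contexts L Y∗ := by
  intro p hp
  rw [mem_contexts_kstar] at hp ⊢
  intro n
  suffices H : contexts L (X ^ n) ⊆ contexts L (Y ^ n) from H (hp n)
  induction n with
  | zero => simp
  | succ n ih => rw [pow_succ, pow_succ]; exact contexts_mul_subset ih h

/-- Inclusion of contexts reverses the order: the premises say that `X` and `Y * Z` lie below `Z`.
Then every `Y ^ n * X` does, and a context fits a union when it fits each member. -/
theorem contexts_kstar_mul {X Y Z : Language α} (hX : contexts L Z ⊆ contexts L X)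
    (hY : contexts L Z ⊆ contexts L (Y * Z)) : contexts L Z ⊆ contexts L (Y∗ * X) := by
  have key (n : ℕ) : contexts L Z ⊆ contexts L (Y ^ n * X) := by
    induction n with
    | zero => simpa using hX
    | succ n ih =>
      rw [pow_succ', mul_assoc]
      exact hY.trans (contexts_mul_subset subset_rfl ih)
  rintro ⟨u, v⟩ h
  refine mem_contexts_mul_iff_left.2 fun x hx => mem_contexts_kstar.2 fun n => ?_
  exact mem_contexts_mul_iff_left.1 (key n h) x hx

theorem contexts_mul_kstar {X Y Z : Language α} (hX : contexts L Z ⊆ contexts L X)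
    (hY : contexts L Z ⊆ contexts L (Z * Y)) : contexts L Z ⊆ contexts L (X * Y∗) := by
  have key (n : ℕ) : contexts L Z ⊆ contexts L (X * Y ^ n) := by
    induction n with
    | zero => simpa using hX
    | succ n ih =>
      rw [pow_succ, ← mul_assoc]
      exact hY.trans (contexts_mul_subset ih subset_rfl)
  rintro ⟨u, v⟩ h
  refine mem_contexts_mul_iff_right.2 fun x hx => mem_contexts_kstar.2 fun n => ?_
  exact mem_contexts_mul_iff_right.1 (key n h) x hx

/-- The equational axioms hold already for languages; closedness of `L` is exactly what the
hypothesis `e ≤ w` needs. -/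
theorem sound_contexts (hL : IsClosed e w L) :
    (expOps α).Sound e (wordExp w) Set.univ
      (fun g h => contexts L g.matches' = contexts L h.matches') := by
  intro a _ b _ c _ d _
  simp only [Ops.rules, List.forall_mem_cons, expOps, RegularExpression.matches'_add,
    RegularExpression.matches'_mul, RegularExpression.matches'_zero,
    RegularExpression.matches'_epsilon, RegularExpression.matches'_star]
  refine ⟨fun _ _ => trivial, fun h _ => h.symm, fun h h' => h.trans h',
    fun h h' => by rw [contexts_add, contexts_add, h, h'],
    fun h h' => (contexts_mul_subset h.le h'.le).antisymm (contexts_mul_subset h.ge h'.ge),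
    fun h _ => (contexts_kstar_subset h.le).antisymm (contexts_kstar_subset h.ge),
    fun _ _ => by rw [add_zero], fun _ _ => by rw [add_idem], fun _ _ => by rw [add_comm],
    fun _ _ => by rw [add_assoc], fun _ _ => by rw [mul_zero], fun _ _ => by rw [zero_mul],
    fun _ _ => by rw [mul_one], fun _ _ => by rw [one_mul], fun _ _ => by rw [mul_assoc],
    fun _ _ => by rw [mul_add], fun _ _ => by rw [add_mul],
    fun _ _ => by rw [one_add_mul_kstar], fun _ _ => by rw [one_add_kstar_mul],
    fun h _ => ?_, fun h _ => ?_, fun _ _ => ?_, by simp⟩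
  · rw [contexts_add, contexts_add, Set.inter_eq_right, Set.subset_inter_iff] at h
    rw [contexts_add, Set.inter_eq_right]
    exact contexts_kstar_mul h.1 h.2
  · rw [contexts_add, contexts_add, Set.inter_eq_right, Set.subset_inter_iff] at h
    rw [contexts_add, Set.inter_eq_right]
    exact contexts_mul_kstar h.1 h.2
  · rw [contexts_add, Set.inter_eq_right, matches'_wordExp]
    rintro ⟨u, v⟩ h y hy
    exact hL u v (h w rfl) y hy

/-- Whether `u x v` is accepted depends on `u` and `v` only through the relations they induce on the
finite state set. -/
theorem finite_range_contexts (B : Automaton α) [Finite B.State] :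
    (Set.range (contexts B.language)).Finite := by
  let ρ (u : List α) : Set (B.State × B.State) := {p | B.Trace p.1 u p.2}
  refine (Set.finite_range (Set.preimage (Prod.map ρ ρ))).subset ?_
  rintro _ ⟨X, rfl⟩
  refine ⟨{p | ∀ x ∈ X, ∃ y z, (B.init, y) ∈ p.1 ∧ B.Trace y x z ∧ (z, B.final) ∈ p.2}, ?_⟩
  ext ⟨u, v⟩
  refine forall₂_congr fun x _ => ?_
  constructor
  · rintro ⟨y, z, h1, h2, h3⟩
    exact (h1.append h2).append h3
  · intro h
    obtain ⟨z, h, h3⟩ := Automaton.Trace.split h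
    obtain ⟨y, h1, h2⟩ := Automaton.Trace.split h
    exact ⟨y, z, h1, h2, h3⟩

end Contexts

/-! ### Folding over codes -/

/-- The algebra of codes. -/
def codeOps : Ops ℕ where
  zero := 0
  one := 1
  plus x y := 4 * Nat.pair x y + 3
  comp x y := 4 * Nat.pair x y + 4
  star x := 4 * x + 5

theorem isHom_code [Fintype α] : Ops.IsHom (expOps α) codeOps code :=
  ⟨rfl, rfl, fun _ _ => rfl, fun _ _ => rfl, fun _ => rfl⟩

theorem unpair_div_four_lt (n : ℕ) :
    (n / 4).unpair.1 < n + 2 ∧ (n / 4).unpair.2 < n + 2 ∧ n / 4 < n + 2 := by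
  have h1 := Nat.unpair_left_le (n / 4)
  have h2 := Nat.unpair_right_le (n / 4)
  omega

/-- The value of a code in the algebra `O`, where `ch` interprets the letters. -/
def foldCode {T : Type v} (O : Ops T) (ch : ℕ → T) : ℕ → T
  | 0 => O.zero
  | 1 => O.one
  | n + 2 =>
    have := unpair_div_four_lt n
    match n % 4 with
    | 0 => ch (n / 4)
    | 1 => O.plus (foldCode O ch (n / 4).unpair.1) (foldCode O ch (n / 4).unpair.2)
    | 2 => O.comp (foldCode O ch (n / 4).unpair.1) (foldCode O ch (n / 4).unpair.2)
    | _ => O.star (foldCode O ch (n / 4))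
termination_by n => n
decreasing_by all_goals omega

theorem foldCode_char {T : Type v} (O : Ops T) (ch : ℕ → T) (i : ℕ) :
    foldCode O ch (4 * i + 2) = ch i := by
  rw [foldCode, show 4 * i % 4 = 0 by omega, show 4 * i / 4 = i by omega]
  rfl

theorem isHom_foldCode {T : Type v} (O : Ops T) (ch : ℕ → T) :
    Ops.IsHom codeOps O (foldCode O ch) where
  zero := by rw [codeOps, foldCode]
  one := by rw [codeOps, foldCode]
  plus a b := by
    change foldCode O ch ((4 * Nat.pair a b + 1) + 2) = _
    rw [foldCode, show (4 * Nat.pair a b + 1) % 4 = 1 by omega,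
      show (4 * Nat.pair a b + 1) / 4 = Nat.pair a b by omega, Nat.unpair_pair]
    rfl
  comp a b := by
    change foldCode O ch ((4 * Nat.pair a b + 2) + 2) = _
    rw [foldCode, show (4 * Nat.pair a b + 2) % 4 = 2 by omega,
      show (4 * Nat.pair a b + 2) / 4 = Nat.pair a b by omega, Nat.unpair_pair]
    rfl
  star a := by
    change foldCode O ch ((4 * a + 3) + 2) = _
    rw [foldCode, show (4 * a + 3) % 4 = 3 by omega, show (4 * a + 3) / 4 = a by omega]
    rfl

theorem Ops.IsHom.trans {T₁ T₂ T₃ : Type*} {O₁ : Ops T₁} {O₂ : Ops T₂} {O₃ : Ops T₃}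
    {f : T₁ → T₂} {g : T₂ → T₃} (hg : IsHom O₂ O₃ g) (hf : IsHom O₁ O₂ f) :
    IsHom O₁ O₃ (g ∘ f) := by
  constructor <;> intros <;>
    simp only [Function.comp, hf.zero, hg.zero, hf.one, hg.one, hf.plus, hg.plus, hf.comp,
      hg.comp, hf.star, hg.star]

/-- The expression with a given code. -/
noncomputable def decodeExp (α : Type u) [Fintype α] : ℕ → RegularExpression α :=
  foldCode (expOps α) fun i =>
    -- Indices beyond the alphabet denote no letter; the value `0` is arbitrary and makes decoding
    -- total.
    if h : i < Fintype.card α then .char ((Fintype.equivFin α).symm ⟨i, h⟩) else 0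

theorem decodeExp_code [Fintype α] (g : RegularExpression α) : decodeExp α (code g) = g := by
  have hd : Ops.IsHom codeOps (expOps α) (decodeExp α) := isHom_foldCode _ _
  induction g with
  | zero => exact hd.zero
  | epsilon => exact hd.one
  | char a =>
    refine (foldCode_char _ _ _).trans ?_
    simp
  | plus f g ihf ihg => exact (hd.plus _ _).trans (congrArg₂ _ ihf ihg)
  | comp f g ihf ihg => exact (hd.comp _ _).trans (congrArg₂ _ ihf ihg)
  | star f ih => exact (hd.star _).trans (congrArg _ ih)

/-! ### Enumeration of the provable equations -/

/-- The pairs of codes derived in the first `n` steps. Step `n` applies all rules, with the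
parameters that `n` encodes, to the pairs derived before. -/
def derived (ce cw : ℕ) : ℕ → List (ℕ × ℕ)
  -- The pair `0 = 0` must be present at the start, since it stands for missing premises.
  | 0 => [(0, 0)]
  | n + 1 => derived ce cw n ++
      (codeOps.rules ce cw n.unpair.1 n.unpair.2.unpair.1 n.unpair.2.unpair.2.unpair.1
        n.unpair.2.unpair.2.unpair.2.unpair.1).flatMap fun r =>
          if (∃ q ∈ derived ce cw n, q = r.1) ∧ (∃ q ∈ derived ce cw n, q = r.2.1) then [r.2.2]
          else []

theorem derived_mono (ce cw : ℕ) : Monotone (fun n => {p | p ∈ derived ce cw n}) :=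
  monotone_nat_of_le_succ fun _ _ hp => List.mem_append_left _ hp

theorem sound_derived (ce cw : ℕ) :
    codeOps.Sound ce cw Set.univ (fun x y => ∃ n, (x, y) ∈ derived ce cw n) := by
  rintro a - b - c - d - r hr ⟨i, hi⟩ ⟨j, hj⟩
  -- The last component is padding: it makes step `n` late enough for both premises to have been
  -- derived.
  let n := Nat.pair a (Nat.pair b (Nat.pair c (Nat.pair d (i + j))))
  have hn : i + j ≤ n := (Nat.right_le_pair _ _).trans <| (Nat.right_le_pair _ _).trans <|
    (Nat.right_le_pair _ _).trans (Nat.right_le_pair _ _)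
  refine ⟨n + 1, List.mem_append_right _ (List.mem_flatMap.2 ⟨r, by simpa [n] using hr, ?_⟩)⟩
  rw [if_pos]
  · exact List.mem_singleton_self _
  · exact ⟨⟨_, derived_mono ce cw ((Nat.le_add_right i j).trans hn) hi, rfl⟩,
      ⟨_, derived_mono ce cw ((Nat.le_add_left j i).trans hn) hj, rfl⟩⟩

theorem rel_of_mem_derived {ce cw : ℕ} {R : ℕ → ℕ → Prop}
    (hR : codeOps.Sound ce cw Set.univ R) (h0 : R 0 0) {n : ℕ} :
    ∀ p ∈ derived ce cw n, R p.1 p.2 := by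
  induction n with
  | zero => simpa [derived] using h0
  | succ n ih =>
    intro p hp
    rcases List.mem_append.1 hp with hp | hp
    · exact ih p hp
    · obtain ⟨r, hr, hp⟩ := List.mem_flatMap.1 hp
      split_ifs at hp with h
      · obtain ⟨⟨_, h1, rfl⟩, ⟨_, h2, rfl⟩⟩ := h
        rw [List.mem_singleton.1 hp]
        exact hR _ trivial _ trivial _ trivial _ trivial r hr (ih _ h1) (ih _ h2)
      · cases hp

theorem equiv_iff_exists_mem_derived [Fintype α] {e : RegularExpression α} {w : List α}
    {g h : RegularExpression α} : Equiv (linearHyp e w) g h ↔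
      ∃ n, (code g, code h) ∈ derived (code e) (code (wordExp w)) n := by
  constructor
  · exact Equiv.rel_of_sound ((sound_derived _ _).comap isHom_code fun _ => trivial)
      ⟨0, by simp [derived, code]⟩
  · rintro ⟨n, hn⟩
    have hd : Ops.IsHom codeOps (expOps α) (decodeExp α) := isHom_foldCode _ _
    have hs : (expOps α).Sound (decodeExp α (code e)) (decodeExp α (code (wordExp w))) Set.univ
        (Equiv (linearHyp e w)) := by
      rw [decodeExp_code, decodeExp_code]
      exact sound_equiv
    have := rel_of_mem_derived (hs.comap hd fun _ => trivial) (.refl _) _ hn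
    rwa [decodeExp_code, decodeExp_code] at this

/-! ### Finite models given by tables -/

/-- The algebra on natural numbers in which the value of each operation is the entry of the table
`F` at the code of that operation. -/
def tableOps (F : List ℕ) : Ops ℕ where
  zero := F.getD 0 0
  one := F.getD 1 0
  plus x y := F.getD (4 * Nat.pair x y + 3) 0
  comp x y := F.getD (4 * Nat.pair x y + 4) 0
  star x := F.getD (4 * x + 5) 0

/-- The value of a code in the algebra given by a table. -/
def tableEval (F : List ℕ) : ℕ → ℕ := foldCode (tableOps F) fun i => F.getD (4 * i + 2) 0

/-- The rules hold in the algebra given by a table, for all values of the table. -/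
def IsModel (ce cw : ℕ) (F : List ℕ) : Prop :=
  -- The value `0` is included because lookups beyond the end of the table return it.
  (tableOps F).Sound (tableEval F ce) (tableEval F cw) {x | x ∈ 0 :: F} Eq

theorem getD_mem (F : List ℕ) (i : ℕ) : F.getD i 0 ∈ 0 :: F := by
  rw [List.getD_eq_getElem?_getD]
  rcases h : F[i]? with _ | x
  · simp
  · simpa using Or.inr (List.mem_of_getElem? h)

theorem tableEval_mem (F : List ℕ) (n : ℕ) : tableEval F n ∈ 0 :: F := by
  rw [tableEval]
  match n with
  | 0 => rw [foldCode]; exact getD_mem F _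
  | 1 => rw [foldCode]; exact getD_mem F _
  | n + 2 => rw [foldCode]; split <;> exact getD_mem F _

theorem IsModel.tableEval_eq [Fintype α] {e : RegularExpression α} {w : List α} {F : List ℕ}
    (hF : IsModel (code e) (code (wordExp w)) F) {g h : RegularExpression α}
    (hgh : Equiv (linearHyp e w) g h) : tableEval F (code g) = tableEval F (code h) := by
  have hom : Ops.IsHom (expOps α) (tableOps F) (tableEval F ∘ code) :=
    (isHom_foldCode _ _).trans isHom_code
  exact hgh.rel_of_sound (hF.comap hom fun _ => tableEval_mem F _) rfl

/-- A congruence of finite index that satisfies the rules is given by a table. -/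
theorem exists_isModel [Fintype α] {e : RegularExpression α} {w : List α} {V : Type*}
    (val : RegularExpression α → V) (hval : (Set.range val).Finite)
    (hs : (expOps α).Sound e (wordExp w) Set.univ (fun g h => val g = val h)) :
    ∃ F, IsModel (code e) (code (wordExp w)) F ∧
      ∀ g h, tableEval F (code g) = tableEval F (code h) ↔ val g = val h := by
  classical
  have hex (g : RegularExpression α) : ∃ n, ∃ h, code h = n ∧ val h = val g := ⟨_, g, rfl, rfl⟩
  -- The least code in the class of `g`; these representatives are the elements of the model.
  let r (g : RegularExpression α) : ℕ := Nat.find (hex g)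
  have hr (g) : ∃ h, code h = r g ∧ val h = val g := Nat.find_spec (hex g)
  have hr_congr {g h} (hgh : val g = val h) : r g = r h := by simp only [r, hgh]
  have hr_iff {g h} : r g = r h ↔ val g = val h := by
    refine ⟨fun hgh => ?_, hr_congr⟩
    obtain ⟨g', h1, h2⟩ := hr g
    obtain ⟨h', h3, h4⟩ := hr h
    rw [← h2, ← h4, code_injective (h1.trans (hgh.trans h3.symm))]
  have hr0 : r 0 = 0 := (Nat.find_eq_zero _).2 ⟨0, rfl, rfl⟩
  obtain ⟨m, hm⟩ : ∃ m, ∀ g, r g ≤ m := by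
    have : (Set.range r).Finite := by
      refine (hval.image fun v => if h : ∃ g, val g = v then r h.choose else 0).subset ?_
      rintro _ ⟨g, rfl⟩
      have h : ∃ g', val g' = val g := ⟨g, rfl⟩
      exact ⟨val g, ⟨g, rfl⟩, by simp only [dif_pos h]; exact hr_congr h.choose_spec⟩
    obtain ⟨m, hm⟩ := this.bddAbove
    exact ⟨m, fun g => hm ⟨g, rfl⟩⟩
  -- Exceeds the code of every letter and of every operation applied to representatives, all of
  -- which are at most `m`.
  let N := 4 * ((m + 1) ^ 2 + m + Fintype.card α) + 6
  let F := (List.range N).map fun n => r (decodeExp α n)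
  have hF {n} (hn : n < N) : F.getD n 0 = r (decodeExp α n) := by
    simp [F, List.getD_eq_getElem?_getD, hn]
  have hpair (g h) : Nat.pair (r g) (r h) ≤ (m + 1) ^ 2 :=
    (Nat.pair_lt_max_add_one_sq _ _).le.trans
      (Nat.pow_le_pow_left (Nat.succ_le_succ (max_le (hm g) (hm h))) 2)
  have hd : Ops.IsHom codeOps (expOps α) (decodeExp α) := isHom_foldCode _ _
  have hdr (g) : val (decodeExp α (r g)) = val g := by
    obtain ⟨h, h1, h2⟩ := hr g
    rw [← h1, decodeExp_code, h2]
  have key (a b c d) := hs a trivial b trivial c trivial d trivial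
  simp only [Ops.rules, List.forall_mem_cons] at key
  have hom : Ops.IsHom (expOps α) (tableOps F) r := by
    refine ⟨?_, ?_, fun g h => ?_, fun g h => ?_, fun g => ?_⟩
    · refine ((hF (by omega)).trans (congrArg r ?_)).symm
      exact hd.zero
    · refine ((hF (by omega)).trans (congrArg r ?_)).symm
      exact hd.one
    · have := hpair g h
      refine ((hF (by omega)).trans ?_).symm
      refine (congrArg r (hd.plus (r g) (r h))).trans (hr_congr ?_)
      exact (key _ _ _ _).2.2.2.1 (hdr g) (hdr h)
    · have := hpair g h
      refine ((hF (by omega)).trans ?_).symm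
      refine (congrArg r (hd.comp (r g) (r h))).trans (hr_congr ?_)
      exact (key _ _ _ _).2.2.2.2.1 (hdr g) (hdr h)
    · have := hm g
      refine ((hF (by omega)).trans ?_).symm
      refine (congrArg r (hd.star (r g))).trans (hr_congr ?_)
      exact (key _ _ 0 0).2.2.2.2.2.1 (hdr g) trivial
  have htab : Ops.IsHom codeOps (tableOps F) (tableEval F) := isHom_foldCode _ _
  have heval (g) : tableEval F (code g) = r g := by
    induction g with
    | zero => exact htab.zero.trans hom.zero.symm
    | epsilon => exact htab.one.trans hom.one.symm
    | char a =>
      have ha : ((Fintype.equivFin α a : Fin _) : ℕ) < Fintype.card α := Fin.is_lt _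
      refine (foldCode_char _ _ _).trans ((hF (by omega)).trans ?_)
      rw [show 4 * (Fintype.equivFin α a : ℕ) + 2 = code (.char a) from rfl, decodeExp_code]
    | plus f g ihf ihg => exact (htab.plus _ _).trans (by rw [ihf, ihg]; exact (hom.plus _ _).symm)
    | comp f g ihf ihg => exact (htab.comp _ _).trans (by rw [ihf, ihg]; exact (hom.comp _ _).symm)
    | star f ih => exact (htab.star _).trans (by rw [ih]; exact (hom.star _).symm)
  refine ⟨F, ?_, fun g h => by rw [heval, heval, hr_iff]⟩
  rw [IsModel, heval, heval]
  refine Ops.Sound.map (R := Eq) hom (by simpa only [hr_iff] using hs) ?_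
  intro x hx
  rcases List.mem_cons.1 hx with rfl | hx
  · exact ⟨0, hr0⟩
  · obtain ⟨n, -, rfl⟩ := List.mem_map.1 hx
    exact ⟨_, rfl⟩

/-! ### Primitive recursiveness -/

section Primrec

variable {γ : Type*} [Primcodable γ]

theorem primrec_getD {f : γ → List ℕ} {g : γ → ℕ} (hf : Primrec f) (hg : Primrec g) :
    Primrec fun x => (f x).getD (g x) 0 :=
  (Primrec.list_getD 0).comp hf hg

theorem primrec_affine {f : γ → ℕ} (k : ℕ) (hf : Primrec f) : Primrec fun x => 4 * f x + k :=
  Primrec.nat_add.comp (Primrec.nat_mul.comp (.const 4) hf) (.const k)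

/-- A family of algebras on natural numbers that is uniformly primitive recursive. -/
structure Ops.IsPrimrec (O : γ → Ops ℕ) : Prop where
  zero : Primrec fun x => (O x).zero
  one : Primrec fun x => (O x).one
  plus : ∀ {f g : γ → ℕ}, Primrec f → Primrec g → Primrec fun x => (O x).plus (f x) (g x)
  comp : ∀ {f g : γ → ℕ}, Primrec f → Primrec g → Primrec fun x => (O x).comp (f x) (g x)
  star : ∀ {f : γ → ℕ}, Primrec f → Primrec fun x => (O x).star (f x)

theorem isPrimrec_codeOps : Ops.IsPrimrec fun _ : γ => codeOps where
  zero := .const 0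
  one := .const 1
  plus hf hg := primrec_affine 3 (Primrec₂.natPair.comp hf hg)
  comp hf hg := primrec_affine 4 (Primrec₂.natPair.comp hf hg)
  star hf := primrec_affine 5 hf

theorem isPrimrec_tableOps {F : γ → List ℕ} (hF : Primrec F) :
    Ops.IsPrimrec fun x => tableOps (F x) where
  zero := primrec_getD hF (.const 0)
  one := primrec_getD hF (.const 1)
  plus hf hg := primrec_getD hF (primrec_affine 3 (Primrec₂.natPair.comp hf hg))
  comp hf hg := primrec_getD hF (primrec_affine 4 (Primrec₂.natPair.comp hf hg))
  star hf := primrec_getD hF (primrec_affine 5 hf)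

theorem primrec_rules {O : γ → Ops ℕ} (hO : Ops.IsPrimrec O) {e w a b c d : γ → ℕ}
    (he : Primrec e) (hw : Primrec w) (ha : Primrec a) (hb : Primrec b) (hc : Primrec c)
    (hd : Primrec d) :
    Primrec fun x => (O x).rules (e x) (w x) (a x) (b x) (c x) (d x) := by
  have h0 := hO.zero
  have h1 := hO.one
  simp only [Ops.rules]
  repeat'
    first
    | assumption
    | exact Primrec.const _
    | refine Primrec.list_cons.comp ?_ ?_
    | refine Primrec.pair ?_ ?_
    | refine hO.plus ?_ ?_
    | refine hO.comp ?_ ?_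
    | refine hO.star ?_

theorem primrec_tableEval : Primrec₂ tableEval := by
  -- Course-of-values recursion: `l` lists the values at all codes below `l.length`, and `index l`
  -- is the table position holding the value at `l.length`.
  let index (l : List ℕ) : ℕ :=
    if l.length = 0 then 0 else if l.length = 1 then 1
    else if (l.length - 2) % 4 = 0 then 4 * ((l.length - 2) / 4) + 2
    else if (l.length - 2) % 4 = 1 then
      4 * Nat.pair (l.getD ((l.length - 2) / 4).unpair.1 0)
        (l.getD ((l.length - 2) / 4).unpair.2 0) + 3
    else if (l.length - 2) % 4 = 2 then
      4 * Nat.pair (l.getD ((l.length - 2) / 4).unpair.1 0)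
        (l.getD ((l.length - 2) / 4).unpair.2 0) + 4
    else 4 * l.getD ((l.length - 2) / 4) 0 + 5
  have hlen : Primrec fun l : List ℕ => l.length := Primrec.list_length
  have hsub : Primrec fun l : List ℕ => l.length - 2 := Primrec.nat_sub.comp hlen (.const 2)
  have hdiv : Primrec fun l : List ℕ => (l.length - 2) / 4 := Primrec.nat_div.comp hsub (.const 4)
  have hmod : Primrec fun l : List ℕ => (l.length - 2) % 4 := Primrec.nat_mod.comp hsub (.const 4)
  have hun := Primrec.unpair.comp hdiv
  have hpair := Primrec₂.natPair.comp (primrec_getD .id (Primrec.fst.comp hun))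
    (primrec_getD .id (Primrec.snd.comp hun))
  have hindex : Primrec index :=
    .ite (Primrec.eq.comp hlen (.const 0)) (.const 0) <|
    .ite (Primrec.eq.comp hlen (.const 1)) (.const 1) <|
    .ite (Primrec.eq.comp hmod (.const 0)) (primrec_affine 2 hdiv) <|
    .ite (Primrec.eq.comp hmod (.const 1)) (primrec_affine 3 hpair) <|
    .ite (Primrec.eq.comp hmod (.const 2)) (primrec_affine 4 hpair)
      (primrec_affine 5 (primrec_getD .id hdiv))
  refine Primrec.nat_strong_rec tableEval (g := fun F l => some (F.getD (index l) 0))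
    (Primrec.option_some.comp (primrec_getD .fst (hindex.comp .snd))) fun F n => ?_
  have hget {i : ℕ} (hi : i < n) :
      ((List.range n).map (tableEval F)).getD i 0 = tableEval F i := by
    simp [List.getD_eq_getElem?_getD, hi]
  simp only [index, List.length_map, List.length_range]
  rcases n with _ | _ | n
  · simp [tableEval, foldCode, tableOps]
  · simp [tableEval, foldCode, tableOps]
  · obtain ⟨h1, h2, h3⟩ := unpair_div_four_lt n
    rw [show n + 1 + 1 - 2 = n from rfl, hget h1, hget h2, hget h3, if_neg (by omega), if_neg (by omega)]
    conv_rhs => rw [tableEval, foldCode]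
    have : n % 4 < 4 := Nat.mod_lt _ (by omega)
    generalize n % 4 = m at this
    interval_cases m <;> simp [tableOps, tableEval]

theorem primrec_derived (ce cw : ℕ) : Primrec (derived ce cw) := by
  have hmem : PrimrecRel fun (l : List (ℕ × ℕ)) p => ∃ q ∈ l, q = p :=
    PrimrecRel.exists_mem_list Primrec.eq
  let step (n : ℕ) (T : List (ℕ × ℕ)) : List (ℕ × ℕ) := T ++
      (codeOps.rules ce cw n.unpair.1 n.unpair.2.unpair.1 n.unpair.2.unpair.2.unpair.1
        n.unpair.2.unpair.2.unpair.2.unpair.1).flatMap fun r =>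
          if (∃ q ∈ T, q = r.1) ∧ (∃ q ∈ T, q = r.2.1) then [r.2.2] else []
  have hstep : Primrec₂ step := by
    have h1 : Primrec fun p : ℕ × List (ℕ × ℕ) => p.1.unpair := Primrec.unpair.comp .fst
    have h2 := Primrec.unpair.comp (Primrec.snd.comp h1)
    have h3 := Primrec.unpair.comp (Primrec.snd.comp h2)
    have h4 := Primrec.unpair.comp (Primrec.snd.comp h3)
    refine Primrec.list_append.comp .snd (Primrec.list_flatMap
      (primrec_rules isPrimrec_codeOps (.const ce) (.const cw) (Primrec.fst.comp h1)
        (Primrec.fst.comp h2) (Primrec.fst.comp h3) (Primrec.fst.comp h4)) ?_)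
    have hT : Primrec fun p : (ℕ × List (ℕ × ℕ)) × ((ℕ × ℕ) × (ℕ × ℕ) × (ℕ × ℕ)) => p.1.2 :=
      Primrec.snd.comp .fst
    refine Primrec.ite (PrimrecPred.and (hmem.comp hT (Primrec.fst.comp .snd))
      (hmem.comp hT (Primrec.fst.comp (Primrec.snd.comp .snd)))) ?_ (.const [])
    exact Primrec.list_cons.comp (Primrec.snd.comp (Primrec.snd.comp .snd)) (.const [])
  refine (Primrec.nat_rec₁ [(0, 0)] hstep).of_eq fun n => ?_
  induction n with
  | zero => rfl
  | succ n ih => exact congrArg (step n) ih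

theorem primrecPred_forall_mem {β : Type*} [Primcodable β] {f : γ → List β} {p : γ × β → Prop}
    (hf : Primrec f) (hp : PrimrecPred p) : PrimrecPred fun x => ∀ b ∈ f x, p (x, b) := by
  have : PrimrecRel fun (b : β) (x : γ) => p (x, b) := hp.comp (Primrec.pair .snd .fst)
  exact this.forall_mem_list.comp hf .id

theorem primrecPred_isModel (ce cw : ℕ) : PrimrecPred (IsModel ce cw) := by
  have hl {γ : Type} [Primcodable γ] {F : γ → List ℕ} (hF : Primrec F) :
      Primrec fun x => 0 :: F x := Primrec.list_cons.comp (.const 0) hF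
  have h1 : Primrec fun x : List ℕ × ℕ => x.1 := .fst
  have h2 : Primrec fun x : (List ℕ × ℕ) × ℕ => x.1.1 := h1.comp .fst
  have h3 : Primrec fun x : ((List ℕ × ℕ) × ℕ) × ℕ => x.1.1.1 := h2.comp .fst
  have h4 : Primrec fun x : (((List ℕ × ℕ) × ℕ) × ℕ) × ℕ => x.1.1.1.1 := h3.comp .fst
  have hr : Primrec fun x : ((((List ℕ × ℕ) × ℕ) × ℕ) × ℕ) × ((ℕ × ℕ) × (ℕ × ℕ) × (ℕ × ℕ)) => x.2 :=
    .snd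
  have heq {f : ((((List ℕ × ℕ) × ℕ) × ℕ) × ℕ) × ((ℕ × ℕ) × (ℕ × ℕ) × (ℕ × ℕ)) → ℕ × ℕ}
      (hf : Primrec f) : PrimrecPred fun x => (f x).1 = (f x).2 :=
    Primrec.eq.comp (Primrec.fst.comp hf) (Primrec.snd.comp hf)
  have hp : PrimrecPred fun x : ((((List ℕ × ℕ) × ℕ) × ℕ) × ℕ) × ((ℕ × ℕ) × (ℕ × ℕ) × (ℕ × ℕ)) =>
      x.2.1.1 = x.2.1.2 → x.2.2.1.1 = x.2.2.1.2 → x.2.2.2.1 = x.2.2.2.2 := by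
    refine ((heq (Primrec.fst.comp hr)).not.or
      ((heq (Primrec.fst.comp (Primrec.snd.comp hr))).not.or
        (heq (Primrec.snd.comp (Primrec.snd.comp hr))))).of_eq fun x => ?_
    rw [imp_iff_not_or, imp_iff_not_or]
  exact primrecPred_forall_mem (hl .id) <| primrecPred_forall_mem (hl h1) <|
    primrecPred_forall_mem (hl h2) <| primrecPred_forall_mem (hl h3) <|
    primrecPred_forall_mem (primrec_rules (isPrimrec_tableOps h4)
      (primrec_tableEval.comp h4 (.const ce)) (primrec_tableEval.comp h4 (.const cw))
      (Primrec.snd.comp (Primrec.fst.comp (Primrec.fst.comp .fst)))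
      (Primrec.snd.comp (Primrec.fst.comp .fst)) (Primrec.snd.comp .fst) .snd) hp

end Primrec

/-! ### Decidability -/

/-- If inequivalence over `D` is witnessed by finite models, then equivalence is decidable over
`D`: search for a derivation and for a separating model simultaneously. -/
theorem decidableOn_of_exists_isModel [Fintype α] {e : RegularExpression α} {w : List α}
    {D : Set (RegularExpression α)}
    (hD : ∀ g ∈ D, ∀ h ∈ D, ¬ Equiv (linearHyp e w) g h →
      ∃ F, IsModel (code e) (code (wordExp w)) F ∧
        tableEval F (code g) ≠ tableEval F (code h)) :
    DecidableOn D (Equiv (linearHyp e w)) := by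
  classical
  let ce := code e
  let cw := code (wordExp w)
  -- The number `n` serves both as a number of derivation steps and as the code of a candidate
  -- table.
  let f (p : ℕ × ℕ) (n : ℕ) : Option Bool :=
    if ∃ q ∈ derived ce cw n, q = p then some true
    else if IsModel ce cw (Denumerable.ofNat (List ℕ) n) ∧
      ¬ tableEval (Denumerable.ofNat (List ℕ) n) p.1 = tableEval (Denumerable.ofNat (List ℕ) n) p.2
    then some false else none
  have hf : Primrec₂ f := by
    have hmem : PrimrecRel fun (l : List (ℕ × ℕ)) p => ∃ q ∈ l, q = p :=
      PrimrecRel.exists_mem_list Primrec.eq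
    have hF : Primrec fun p : (ℕ × ℕ) × ℕ => Denumerable.ofNat (List ℕ) p.2 :=
      (Primrec.ofNat _).comp .snd
    exact Primrec.ite (hmem.comp ((primrec_derived ce cw).comp .snd) .fst) (.const _) <|
      Primrec.ite (((primrecPred_isModel ce cw).comp hF).and
        (Primrec.eq.comp (primrec_tableEval.comp hF (Primrec.fst.comp .fst))
          (primrec_tableEval.comp hF (Primrec.snd.comp .fst))).not) (.const _) (.const _)
  refine ⟨fun p => Nat.rfindOpt (f p), Partrec.rfindOpt hf.to_comp, fun g hg h hh => ?_⟩
  have htrue {n} (hn : f (code g, code h) n = some true) : Equiv (linearHyp e w) g h := by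
    simp only [f] at hn
    split_ifs at hn with h1
    · obtain ⟨_, hq, rfl⟩ := h1
      exact equiv_iff_exists_mem_derived.2 ⟨n, hq⟩
    all_goals simp at hn
  have hfalse {n} (hn : f (code g, code h) n = some false) : ¬ Equiv (linearHyp e w) g h := by
    simp only [f] at hn
    split_ifs at hn with h1 h2
    · simp at hn
    · exact fun hgh => h2.2 (h2.1.tableEval_eq hgh)
  have hdom : (Nat.rfindOpt (f (code g, code h))).Dom := by
    rw [Nat.rfindOpt_dom]
    by_cases hgh : Equiv (linearHyp e w) g h
    · obtain ⟨n, hn⟩ := equiv_iff_exists_mem_derived.1 hgh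
      exact ⟨n, true, by simp only [f]; rw [if_pos ⟨_, hn, rfl⟩]; rfl⟩
    · obtain ⟨F, hF, hne⟩ := hD g hg h hh hgh
      refine ⟨Encodable.encode F, false, ?_⟩
      simp only [f, Denumerable.ofNat_encode]
      rw [if_neg, if_pos ⟨hF, hne⟩]
      · rfl
      · rintro ⟨_, hq, rfl⟩
        exact hgh (equiv_iff_exists_mem_derived.2 ⟨_, hq⟩)
  refine ⟨_, Part.get_mem hdom, ?_⟩
  obtain ⟨n, hn⟩ := Nat.rfindOpt_spec (Part.get_mem hdom)
  generalize (Nat.rfindOpt (f (code g, code h))).get hdom = b at hn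
  cases b
  · simpa using hfalse hn
  · simpa using htrue hn

/-! ### Completeness and decidability on the domain of `r₀` -/

section Main

variable [Fintype α] {e : RegularExpression α} {w : List α} {Z : Automaton α}
  {aut : RegularExpression α → Automaton α}

theorem completeOn_dom (hZ : Z.Represents e) (haut : ∀ g, (aut g).Represents g) :
    CompleteOn (linearHyp e w) (r0 e w Z aut).Dom := by
  have key {g h : RegularExpression α} (hh : h ∈ (r0 e w Z aut).Dom)
      (hgh : semH (linearHyp e w) g = semH (linearHyp e w) h) :
      FreeKA.mk (linearHyp e w) g ≤ FreeKA.mk (linearHyp e w) h := by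
    obtain ⟨B, -, hB, hhB, hle⟩ := exists_closed_automaton hZ (haut h) hh
    exact hle g (((matches'_le_semH _ g).trans hgh.le).trans (semH_le hB hhB))
  intro g hg h hh hgh
  exact FreeKA.mk_eq_mk.1 ((key hh hgh).antisymm (key hg hgh.symm))

theorem decidableOn_dom (hZ : Z.Represents e) (haut : ∀ g, (aut g).Represents g) :
    DecidableOn (r0 e w Z aut).Dom (Equiv (linearHyp e w)) := by
  have key {g h : RegularExpression α} (hh : h ∈ (r0 e w Z aut).Dom)
      (hgh : ¬ FreeKA.mk (linearHyp e w) g ≤ FreeKA.mk (linearHyp e w) h) :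
      ∃ F, IsModel (code e) (code (wordExp w)) F ∧
        tableEval F (code g) ≠ tableEval F (code h) := by
    obtain ⟨B, _, hB, hhB, hle⟩ := exists_closed_automaton hZ (haut h) hh
    obtain ⟨F, hF, hval⟩ := exists_isModel (fun g => contexts B.language g.matches')
      ((finite_range_contexts B).subset (by rintro _ ⟨g, rfl⟩; exact ⟨_, rfl⟩)) (sound_contexts hB)
    refine ⟨F, hF, fun heq => hgh (hle g fun x hx => ?_)⟩
    -- The empty context separates: it fits `h`, and fitting `g` would mean `⟦g⟧ ⊆ L(B)`.
    have hmem : ([], []) ∈ contexts B.language h.matches' := fun x hx => by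
      change [] ++ x ++ [] ∈ B.language
      rw [List.append_nil]
      exact hhB hx
    rw [← (hval g h).1 heq] at hmem
    have hx' : [] ++ x ++ [] ∈ B.language := hmem x hx
    rw [List.append_nil] at hx'
    exact hx'
  refine decidableOn_of_exists_isModel fun g hg h hh hgh => ?_
  by_cases hle : FreeKA.mk (linearHyp e w) g ≤ FreeKA.mk (linearHyp e w) h
  · obtain ⟨F, hF, hne⟩ := key hg fun hge => hgh (FreeKA.mk_eq_mk.1 (hle.antisymm hge))
    exact ⟨F, hF, hne.symm⟩
  · exact key hh hle

end Main

end KAHyp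

theorem mainTheorem4 {α : Type*} [Fintype α] (e : RegularExpression α) (w : List α)
    (Z : KAHyp.Automaton α) (hZ : Z.Represents e)
    (aut : RegularExpression α → KAHyp.Automaton α) (haut : ∀ g, (aut g).Represents g) :
    (KAHyp.CompleteOn (KAHyp.linearHyp e w) (KAHyp.r0 e w Z aut).Dom ∧
      KAHyp.DecidableOn (KAHyp.r0 e w Z aut).Dom (KAHyp.Equiv (KAHyp.linearHyp e w))) ∧
    ((∀ g, (KAHyp.r0 e w Z aut g).Dom) →
      KAHyp.CompleteOn (KAHyp.linearHyp e w) Set.univ ∧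
      KAHyp.DecidableOn Set.univ (KAHyp.Equiv (KAHyp.linearHyp e w))) := by
  have h := And.intro (KAHyp.completeOn_dom (w := w) hZ haut) (KAHyp.decidableOn_dom (w := w) hZ haut)
  refine ⟨h, fun hdom => ?_⟩
  rwa [show (KAHyp.r0 e w Z aut).Dom = Set.univ from Set.eq_univ_of_forall hdom] at h
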